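/- Let $\Delta\ge 2$ be an integer and let $0<\lambda<\lambda_c(\Delta)=\frac{\Delta^\Delta}{(\Delta-1)^{\Delta+1}}$. For a finite simple graph $G$ let $Z_I(G,\lambda)=\sum_{I}\lambda^{|I|}$, where $I$ ranges over all independent sets of $G$. A graph on the vertex set $\{1,\dots,n\}$ is accessed through two oracles: $\mathcal D(v)$ returns the degree of the vertex $v$, and $\mathcal N(v,i)$ returns the $i$-th neighbour of $v$ in an arbitrary fixed listing of its neighbours. A (randomized, adaptive) query algorithm for $n$-vertex graphs is a random choice of a deterministic decision tree whose inner nodes are accesses to these oracles and whose leaves carry real outputs; the number of queries is the total number of oracle accesses. For $\epsilon>0$ such an algorithm is called an $\epsilon n$-approximation algorithm for $\log Z_I(G,\lambda)$ on graphs of maximum degree at most $\Delta+1$ if, for every $n$-vertex graph $G$ of maximum degree at most $\Delta+1$, its output $\widehat{z}$ satisfies $|\widehat z-\log Z_I(G,\lambda)|\le\epsilon n$ with probability at least $2/3$. 1. There is a polynomial $P$, depending only on $\Delta$ and $\lambda$, such that for every $n$ and every $\epsilon>0$ there is an $\epsilon n$-approximation algorithm for $\log Z_I(G,\lambda)$ on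 $n$-vertex graphs of maximum degree at most $\Delta+1$ which makes at most $P(1/\epsilon)$ queries on every such graph, for every outcome of its randomness. 2. There are constants $c,C,\epsilon_0>0$, depending only on $\Delta$ and $\lambda$, such that for every $n\ge1$ and every $\epsilon$ with $C/\sqrt n<\epsilon<\epsilon_0$, every $\epsilon n$-approximation algorithm for $\log Z_I(G,\lambda)$ on $n$-vertex graphs of maximum degree at most $\Delta+1$ makes, on some such graph, at least $c/\epsilon^2$ queries in expectation. -/

import Mathlib

open MeasureTheory
open scoped ENNReal

noncomputable section

open Classical in
/-- The independent-set partition function `Z_I(G, lam) = ∑_I lam ^ |I|`, the sum being over all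
independent sets `I` of `G` (the empty set included). -/
def indepPartition {V : Type*} [Fintype V] (G : SimpleGraph V) (lam : ℝ) : ℝ :=
  ∑ I ∈ Finset.univ.filter (fun J : Finset V => G.IsIndepSet (J : Set V)), lam ^ I.card

/-- The critical activity `Δ ^ Δ / (Δ - 1) ^ (Δ + 1)`; meaningful for `2 ≤ Δ`. -/
def criticalActivity (Δ : ℕ) : ℝ :=
  (Δ : ℝ) ^ Δ / ((Δ : ℝ) - 1) ^ (Δ + 1)

/-- A graph on the `n` vertices `Fin n` as an algorithm sees it: a simple graph in which the
neighbours of every vertex are listed in some order, without repetition. -/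
structure OracleGraph (n : ℕ) where
  graph : SimpleGraph (Fin n)
  neighbors : ∀ v : Fin n, Fin (graph.neighborSet v).ncard ≃ graph.neighborSet v

namespace OracleGraph

variable {n : ℕ}

/-- The degree oracle. -/
def degree (G : OracleGraph n) (v : Fin n) : ℕ := (G.graph.neighborSet v).ncard

/-- The neighbour oracle: the `i`-th neighbour of `v` (counted from `0`), and the answer `none` if
`v` has no `i`-th neighbour. -/
def neighbor (G : OracleGraph n) (v : Fin n) (i : ℕ) : Option (Fin n) :=
  if h : i < (G.graph.neighborSet v).ncard then
    some (G.neighbors v ⟨i, h⟩ : Fin n)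
  else none

/-- All degrees are at most `d`. -/
def MaxDegreeLE (G : OracleGraph n) (d : ℕ) : Prop := ∀ v, G.degree v ≤ d

end OracleGraph

/-- A deterministic adaptive query algorithm on graphs with vertex set `Fin n`: at each step it
either stops with a real output, or accesses one of the two oracles and continues in a way that
depends on the answer. -/
inductive QueryTree (n : ℕ) : Type
  | ret (x : ℝ) : QueryTree n
  | askDegree (v : Fin n) (next : ℕ → QueryTree n) : QueryTree n
  | askNeighbor (v : Fin n) (i : ℕ) (next : Option (Fin n) → QueryTree n) : QueryTree n

namespace QueryTree

variable {n : ℕ}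

/-- The output of the algorithm on the input `G`. -/
def output (G : OracleGraph n) : QueryTree n → ℝ
  | ret x => x
  | askDegree v next => (next (G.degree v)).output G
  | askNeighbor v i next => (next (G.neighbor v i)).output G

/-- The total number of oracle accesses that the algorithm makes on the input `G`. -/
def queries (G : OracleGraph n) : QueryTree n → ℕ
  | ret _ => 0
  | askDegree v next => (next (G.degree v)).queries G + 1
  | askNeighbor v i next => (next (G.neighbor v i)).queries G + 1

end QueryTree

/-- A randomized query algorithm on graphs with vertex set `Fin n`: a random choice, from an
arbitrary probability space, of a deterministic one. -/
structure RandQueryAlg (n : ℕ) where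
  Ω : Type
  [mΩ : MeasurableSpace Ω]
  μ : Measure Ω
  [prob : IsProbabilityMeasure μ]
  tree : Ω → QueryTree n
  measurable_output : ∀ G : OracleGraph n, Measurable fun ω => (tree ω).output G
  measurable_queries : ∀ G : OracleGraph n, Measurable fun ω => (tree ω).queries G

attribute [instance] RandQueryAlg.mΩ RandQueryAlg.prob

namespace RandQueryAlg

variable {n : ℕ}

/-- On every input graph `G` of maximum degree at most `d`, the algorithm outputs, with probability
at least `2 / 3`, a number within `δ` of `val G`. -/
def IsApproximation (A : RandQueryAlg n) (d : ℕ) (val : SimpleGraph (Fin n) → ℝ) (δ : ℝ) : Prop :=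
  ∀ G : OracleGraph n, G.MaxDegreeLE d →
    2 / 3 ≤ A.μ.real {ω | |(A.tree ω).output G - val G.graph| ≤ δ}

/-- The expected number of queries that the algorithm makes on the input `G`. -/
def expectedQueries (A : RandQueryAlg n) (G : OracleGraph n) : ℝ≥0∞ :=
  ∫⁻ ω, ((A.tree ω).queries G : ℝ≥0∞) ∂A.μ

end RandQueryAlg

end

noncomputable section

/-! ### Contraction of the tree recursion -/

/-! Upper bound. Building the graph one vertex at a time writes `log Z` as a sum over `v` of `log (1
+ x)`, where `x` is the occupation ratio of `v` in front of the later vertices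
(`log_indepPartition_eq_sum`). Deleting the neighbours of `v` in turn expresses `x` through the
ratios at those neighbours (`occCoord_eq`), as in Weitz's recursion but without building a
self-avoiding-walk tree. With `x = sinh² s` the recursion reads `sinh s = √lam * ∏ 1 / cosh (s i)`.
In the coordinate `s` and the sup norm it contracts, at a rate below 1 when `lam` is subcritical and
at most `Δ` neighbours remain (`contraction_bound`). Below the root this always holds, because the
parent has been deleted; the root costs one bounded factor. Depth `O(log (1/ε))` thus gives each
term up to `ε / 2` with polynomially many queries, and averaging over `O(1/ε²)` uniform vertices
suffices by Chebyshev.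

Lower bound. Split the vertices into pairs and join each pair by an edge according to an independent
bit. Then `log Z` is affine in the number of edges (`log_indepPartition_pairGraph`), so the
algorithm must tell bias `1/2 + δ` from `1/2 - δ` with `δ` proportional to `ε`. Each query reveals
at most one bit. By induction on the decision tree, the Hellinger affinity of the acceptance
probabilities under the two biases drops by at most `1 - √(1 - 4δ²)` times the expected number of
queries under fair bits (`affinityBound_of_answersLocally`). Hence order `1/ε²` queries are needed.
-/

theorem pow_mul_sub_le_one (k : ℕ) {z : ℝ} (hz : 0 ≤ z) :
    z ^ k * ((k + 1) - k * z) ≤ 1 := by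
  induction k with
  | zero => simp
  | succ k ih =>
    -- Passing from `k` to `k + 1` subtracts exactly this term, which vanishes at the maximiser `z =
    -- 1`.
    have h : 0 ≤ (k + 1) * (z ^ k * (z - 1) ^ 2) := by positivity
    push_cast
    have e : z ^ (k + 1) * ((k + 1 : ℝ) + 1 - (k + 1) * z)
        = z ^ k * ((k + 1) - k * z) - (k + 1) * (z ^ k * (z - 1) ^ 2) := by ring
    linarith

theorem criticalActivity_pos {Δ : ℕ} (hΔ : 2 ≤ Δ) : 0 < criticalActivity Δ := by
  have : (2 : ℝ) ≤ Δ := by exact_mod_cast hΔ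
  unfold criticalActivity
  have : (0 : ℝ) < (Δ : ℝ) - 1 := by linarith
  positivity

/-- Here `w` plays the role of `1 / (1 + x)`. Equality holds at `w = (Δ - 1) / Δ`, the fixed point
of the symmetric recursion at the critical activity; rescaling moves this point to `z = 1`. -/
theorem criticalActivity_mul_le_one {Δ : ℕ} (hΔ : 2 ≤ Δ) {w : ℝ} (hw : 0 ≤ w) :
    criticalActivity Δ * (((Δ : ℝ) ^ 2 * (1 - w) - 1) * w ^ Δ) ≤ 1 := by
  have h2 : (2 : ℝ) ≤ Δ := by exact_mod_cast hΔ
  have h1 : (0 : ℝ) < (Δ : ℝ) - 1 := by linarith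
  have h := pow_mul_sub_le_one Δ (z := w * Δ / (Δ - 1)) (by positivity)
  refine le_of_eq_of_le ?_ h
  unfold criticalActivity
  rw [div_pow, mul_pow, pow_succ]
  field_simp
  ring

/-- The squared contraction rate of the tree recursion in the coordinate `arsinh √x`. -/
def contractionSq (Δ : ℕ) (lam : ℝ) : ℝ :=
  (lam / criticalActivity Δ + lam) / (1 + lam)

theorem contractionSq_pos {Δ : ℕ} (hΔ : 2 ≤ Δ) {lam : ℝ} (hlam : 0 < lam) :
    0 < contractionSq Δ lam := by
  have := criticalActivity_pos hΔ
  unfold contractionSq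
  positivity

theorem contractionSq_lt_one {Δ : ℕ} (hΔ : 2 ≤ Δ) {lam : ℝ} (hlam : 0 < lam)
    (hlam' : lam < criticalActivity Δ) : contractionSq Δ lam < 1 := by
  have h := criticalActivity_pos hΔ
  unfold contractionSq
  rw [div_lt_one (by positivity)]
  have := (div_lt_one h).2 hlam'
  linarith

/-- The case of `Δ` equal children, with `1 - w = tanh²`. With `θ = lam / criticalActivity Δ` and `B
= lam * w ^ Δ ≤ lam`, the left side is at most `θ + B`, and `(θ + B) / (1 + B)` increases in `B`
because `θ < 1`. -/
theorem symmetric_contraction {Δ : ℕ} (hΔ : 2 ≤ Δ) {lam : ℝ} (hlam : 0 < lam)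
    (hlam' : lam < criticalActivity Δ) {w : ℝ} (hw : 0 ≤ w) (hw1 : w ≤ 1) :
    (Δ : ℝ) ^ 2 * (1 - w) * (lam * w ^ Δ) ≤ contractionSq Δ lam * (1 + lam * w ^ Δ) := by
  have hc := criticalActivity_pos hΔ
  set θ := lam / criticalActivity Δ with hθ
  have hθ1 : θ < 1 := (div_lt_one hc).2 hlam'
  have h1 : lam * (((Δ : ℝ) ^ 2 * (1 - w) - 1) * w ^ Δ) ≤ θ := by
    have := mul_le_mul_of_nonneg_left (criticalActivity_mul_le_one hΔ hw)
      (show 0 ≤ θ by positivity)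
    have e : θ * criticalActivity Δ = lam := by rw [hθ]; field_simp
    rw [← mul_assoc, e] at this
    linarith
  have hB : lam * w ^ Δ ≤ lam := by
    have := pow_le_one₀ hw hw1 (n := Δ)
    nlinarith
  have h2 : θ + lam * w ^ Δ ≤ contractionSq Δ lam * (1 + lam * w ^ Δ) := by
    unfold contractionSq
    rw [← hθ, div_mul_eq_mul_div, le_div_iff₀ (by positivity)]
    nlinarith [mul_nonneg (sub_nonneg.2 hB) (sub_nonneg.2 hθ1.le)]
  linarith

/-- AM-GM for the factors padded with ones up to length `Δ`, proved with the tangent line of `log`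
at `1 - τ`. That tangent line is nonnegative at 1 (`h0`), so padding only helps. -/
theorem prod_one_sub_le_pow {ι : Type*} (s : Finset ι) (t : ι → ℝ) {Δ : ℕ} (hΔ : 0 < Δ)
    (hs : s.card ≤ Δ) (ht0 : ∀ i ∈ s, 0 ≤ t i) (ht : ∀ i ∈ s, t i < 1) :
    ∏ i ∈ s, (1 - t i) ≤ (1 - (∑ i ∈ s, t i) / Δ) ^ Δ := by
  have hΔ' : (0 : ℝ) < Δ := by exact_mod_cast hΔ
  have hs' : (s.card : ℝ) ≤ Δ := by exact_mod_cast hs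
  set τ := (∑ i ∈ s, t i) / Δ with hτ
  have hsum : ∑ i ∈ s, t i = Δ * τ := by rw [hτ]; field_simp
  have hτ1 : τ < 1 := by
    rw [hτ, div_lt_one hΔ']
    rcases s.eq_empty_or_nonempty with rfl | hne
    · simpa using hΔ
    · calc ∑ i ∈ s, t i < ∑ i ∈ s, 1 := Finset.sum_lt_sum_of_nonempty hne ht
        _ ≤ Δ := by simpa using hs'
  have hw : 0 < 1 - τ := by linarith
  have key : ∀ x : ℝ, 0 < x → Real.log x ≤ Real.log (1 - τ) + (x / (1 - τ) - 1) := by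
    intro x hx
    have := Real.log_le_sub_one_of_pos (div_pos hx hw)
    rw [Real.log_div hx.ne' hw.ne'] at this
    linarith
  have h0 := key 1 one_pos
  rw [Real.log_one] at h0
  rw [← Real.log_le_log_iff (Finset.prod_pos fun i hi => by linarith [ht i hi]) (by positivity),
    Real.log_prod (fun i hi => by linarith [ht i hi]), Real.log_pow]
  calc ∑ i ∈ s, Real.log (1 - t i)
      ≤ ∑ i ∈ s, (Real.log (1 - τ) + ((1 - t i) / (1 - τ) - 1)) :=
        Finset.sum_le_sum fun i hi => key _ (by linarith [ht i hi])
    _ = s.card * (Real.log (1 - τ) + (1 / (1 - τ) - 1)) - Δ * τ / (1 - τ) := by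
        rw [← hsum, Finset.sum_div, ← nsmul_eq_mul, ← Finset.sum_const, ← Finset.sum_sub_distrib]
        refine Finset.sum_congr rfl fun i _ => ?_
        ring
    _ ≤ Δ * (Real.log (1 - τ) + (1 / (1 - τ) - 1)) - Δ * τ / (1 - τ) := by gcongr
    _ = Δ * Real.log (1 - τ) := by field_simp; ring

/-- The product `√lam * ∏ 1 / cosh z i` of the tree recursion. -/
def coshProd {ι : Type*} (lam : ℝ) (s : Finset ι) (z : ι → ℝ) : ℝ :=
  √lam * ∏ i ∈ s, (Real.cosh (z i))⁻¹

theorem coshProd_pos {ι : Type*} {lam : ℝ} (hlam : 0 < lam) (s : Finset ι) (z : ι → ℝ) :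
    0 < coshProd lam s z :=
  mul_pos (Real.sqrt_pos.2 hlam) (Finset.prod_pos fun _ _ => inv_pos.2 (Real.cosh_pos _))

theorem hasDerivAt_coshProd {ι : Type*} (lam : ℝ) (s : Finset ι) (a b : ι → ℝ) (t : ℝ) :
    HasDerivAt (fun t : ℝ => coshProd lam s fun i => a i + t * b i)
      (-(coshProd lam s fun i => a i + t * b i) * ∑ i ∈ s, Real.tanh (a i + t * b i) * b i) t := by
  have hc : ∀ i, HasDerivAt (fun t : ℝ => (Real.cosh (a i + t * b i))⁻¹)
      (-((Real.cosh (a i + t * b i))⁻¹ * (Real.tanh (a i + t * b i) * b i))) t := by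
    intro i
    have h1 : HasDerivAt (fun t : ℝ => a i + t * b i) (b i) t := by
      simpa using ((hasDerivAt_id t).mul_const (b i)).const_add (a i)
    refine (h1.cosh.inv (Real.cosh_pos _).ne').congr_deriv ?_
    rw [Real.tanh_eq_sinh_div_cosh]
    have := (Real.cosh_pos (a i + t * b i)).ne'
    field_simp
  unfold coshProd
  induction s using Finset.cons_induction with
  | empty => simpa using hasDerivAt_const t (√lam)
  | cons j s hj ih =>
    simp only [Finset.prod_cons, Finset.sum_cons]
    have h := (hc j).mul ih
    refine (h.congr_deriv ?_).congr_of_eventuallyEq (Filter.Eventually.of_forall fun t => ?_)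
    · beta_reduce
      ring
    · simp only [Pi.mul_apply]
      ring

/-- Mean value inequality along the segment from `a` to `b`. Nonnegative coordinates make every
`tanh` nonnegative, so the `ℓ¹` norm of the gradient is the expression bounded in `hK`. -/
theorem abs_arsinh_coshProd_sub_le {ι : Type*} {lam : ℝ} (hlam : 0 < lam) (s : Finset ι) {K e : ℝ}
    (he : 0 ≤ e)
    (hK : ∀ z : ι → ℝ,
      coshProd lam s z / √(1 + coshProd lam s z ^ 2) * ∑ i ∈ s, Real.tanh (z i) ≤ K)
    (a b : ι → ℝ) (ha : ∀ i ∈ s, 0 ≤ a i) (hb : ∀ i ∈ s, 0 ≤ b i)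
    (hab : ∀ i ∈ s, |b i - a i| ≤ e) :
    |Real.arsinh (coshProd lam s b) - Real.arsinh (coshProd lam s a)| ≤ K * e := by
  set z : ℝ → ι → ℝ := fun t i => a i + t * (b i - a i) with hz
  have hd : ∀ t ∈ Set.Icc (0 : ℝ) 1, HasDerivWithinAt (fun t => Real.arsinh (coshProd lam s (z t)))
      ((√(1 + coshProd lam s (z t) ^ 2))⁻¹ *
        (-(coshProd lam s (z t)) * ∑ i ∈ s, Real.tanh (z t i) * (b i - a i))) (Set.Icc 0 1) t := by
    intro t _
    have := (hasDerivAt_coshProd lam s a (fun i => b i - a i) t).arsinh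
    exact this.hasDerivWithinAt
  have hb' : ∀ t ∈ Set.Icc (0 : ℝ) 1, ‖(√(1 + coshProd lam s (z t) ^ 2))⁻¹ *
        (-(coshProd lam s (z t)) * ∑ i ∈ s, Real.tanh (z t i) * (b i - a i))‖ ≤ K * e := by
    intro t ht
    have hz0 : ∀ i ∈ s, 0 ≤ z t i := by
      intro i hi
      have e1 : z t i = (1 - t) * a i + t * b i := by simp only [hz]; ring
      rw [e1]
      exact add_nonneg (mul_nonneg (by linarith [ht.2]) (ha i hi)) (mul_nonneg ht.1 (hb i hi))
    have hy := coshProd_pos hlam s (z t)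
    have hsum : |∑ i ∈ s, Real.tanh (z t i) * (b i - a i)| ≤ (∑ i ∈ s, Real.tanh (z t i)) * e := by
      refine (Finset.abs_sum_le_sum_abs _ _).trans ?_
      rw [Finset.sum_mul]
      refine Finset.sum_le_sum fun i hi => ?_
      have h0 : 0 ≤ Real.tanh (z t i) := by
        rw [Real.tanh_eq_sinh_div_cosh]
        exact div_nonneg (Real.sinh_nonneg_iff.2 (hz0 i hi)) (Real.cosh_pos _).le
      rw [abs_mul, abs_of_nonneg h0]
      exact mul_le_mul_of_nonneg_left (hab i hi) h0
    rw [Real.norm_eq_abs, abs_mul, abs_mul, abs_neg, abs_of_pos hy, abs_inv,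
      abs_of_nonneg (Real.sqrt_nonneg _)]
    calc (√(1 + coshProd lam s (z t) ^ 2))⁻¹ * (coshProd lam s (z t) *
          |∑ i ∈ s, Real.tanh (z t i) * (b i - a i)|)
        ≤ (√(1 + coshProd lam s (z t) ^ 2))⁻¹ * (coshProd lam s (z t) *
          ((∑ i ∈ s, Real.tanh (z t i)) * e)) := by gcongr
      _ = (coshProd lam s (z t) / √(1 + coshProd lam s (z t) ^ 2) *
            ∑ i ∈ s, Real.tanh (z t i)) * e := by ring
      _ ≤ K * e := mul_le_mul_of_nonneg_right (hK _) he
  have := (convex_Icc (0 : ℝ) 1).norm_image_sub_le_of_norm_hasDerivWithin_le hd hb'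
    (Set.left_mem_Icc.2 zero_le_one) (Set.right_mem_Icc.2 zero_le_one)
  simpa [hz] using this

theorem tanh_sq_eq (x : ℝ) : Real.tanh x ^ 2 = 1 - (Real.cosh x)⁻¹ ^ 2 := by
  have h := (Real.cosh_pos x).ne'
  rw [Real.tanh_eq_sinh_div_cosh, div_pow, Real.sinh_sq]
  field_simp

theorem coshProd_sq {ι : Type*} {lam : ℝ} (hlam : 0 < lam) (s : Finset ι) (z : ι → ℝ) :
    coshProd lam s z ^ 2 = lam * ∏ i ∈ s, (1 - Real.tanh (z i) ^ 2) := by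
  rw [coshProd, mul_pow, Real.sq_sqrt hlam.le, ← Finset.prod_pow]
  congr 1
  exact Finset.prod_congr rfl fun i _ => by rw [tanh_sq_eq]; ring

/-- Equal children are the worst case: in terms of the mean `τ` of the `tanh²`, Cauchy-Schwarz
bounds the sum and AM-GM bounds the product, and `Y / (1 + Y)` is increasing. -/
theorem contraction_bound {ι : Type*} {Δ : ℕ} (hΔ : 2 ≤ Δ) {lam : ℝ} (hlam : 0 < lam)
    (hlam' : lam < criticalActivity Δ) (s : Finset ι) (hs : s.card ≤ Δ) (z : ι → ℝ) :
    coshProd lam s z / √(1 + coshProd lam s z ^ 2) * ∑ i ∈ s, Real.tanh (z i)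
      ≤ √(contractionSq Δ lam) := by
  apply Real.le_sqrt_of_sq_le
  have hΔ' : (0 : ℝ) < Δ := by exact_mod_cast (by omega : 0 < Δ)
  have hs' : (s.card : ℝ) ≤ Δ := by exact_mod_cast hs
  rw [mul_pow, div_pow, Real.sq_sqrt (by positivity)]
  have ht0 : ∀ i ∈ s, 0 ≤ Real.tanh (z i) ^ 2 := fun i _ => sq_nonneg _
  have ht1 : ∀ i ∈ s, Real.tanh (z i) ^ 2 < 1 := fun i _ => by
    rw [tanh_sq_eq]
    have := pow_pos (inv_pos.2 (Real.cosh_pos (z i))) 2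
    linarith
  have hAG := prod_one_sub_le_pow s (fun i => Real.tanh (z i) ^ 2) (by omega : 0 < Δ) hs ht0 ht1
  set τ := (∑ i ∈ s, Real.tanh (z i) ^ 2) / Δ with hτ
  have hτ0 : 0 ≤ τ := div_nonneg (Finset.sum_nonneg ht0) hΔ'.le
  have hτ1 : τ ≤ 1 := by
    rw [hτ, div_le_one hΔ']
    calc _ ≤ ∑ i ∈ s, (1 : ℝ) := Finset.sum_le_sum fun i hi => (ht1 i hi).le
      _ ≤ Δ := by simpa using hs'
  have hCS : (∑ i ∈ s, Real.tanh (z i)) ^ 2 ≤ (Δ : ℝ) ^ 2 * τ := by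
    calc _ ≤ (s.card : ℝ) * ∑ i ∈ s, Real.tanh (z i) ^ 2 := sq_sum_le_card_mul_sum_sq
      _ ≤ Δ * ∑ i ∈ s, Real.tanh (z i) ^ 2 :=
          mul_le_mul_of_nonneg_right hs' (Finset.sum_nonneg ht0)
      _ = (Δ : ℝ) ^ 2 * τ := by rw [hτ]; field_simp
  have hY : coshProd lam s z ^ 2 ≤ lam * (1 - τ) ^ Δ := by
    rw [coshProd_sq hlam]
    exact mul_le_mul_of_nonneg_left hAG hlam.le
  set Y := coshProd lam s z ^ 2
  have hY0 : 0 ≤ Y := sq_nonneg _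
  set F := lam * (1 - τ) ^ Δ
  have hsym := symmetric_contraction hΔ hlam hlam' (w := 1 - τ) (by linarith) (by linarith)
  rw [sub_sub_cancel] at hsym
  have hYF : Y / (1 + Y) ≤ F / (1 + F) := by
    rw [div_le_div_iff₀ (by linarith) (by linarith)]
    linarith
  calc Y / (1 + Y) * (∑ i ∈ s, Real.tanh (z i)) ^ 2 ≤ F / (1 + F) * ((Δ : ℝ) ^ 2 * τ) := by
        gcongr
    _ ≤ contractionSq Δ lam := by
        rw [div_mul_eq_mul_div, div_le_iff₀ (by linarith)]
        linarith

/-- Serves only at the root, where no neighbour need have been deleted and contraction may fail. -/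
theorem crude_bound {ι : Type*} {lam : ℝ} (hlam : 0 < lam) (s : Finset ι) {d : ℕ}
    (hs : s.card ≤ d) (z : ι → ℝ) :
    coshProd lam s z / √(1 + coshProd lam s z ^ 2) * ∑ i ∈ s, Real.tanh (z i) ≤ d := by
  have hy := coshProd_pos hlam s z
  have h1 : coshProd lam s z / √(1 + coshProd lam s z ^ 2) ≤ 1 := by
    rw [div_le_one (by positivity)]
    apply Real.le_sqrt_of_sq_le
    linarith
  have h2 : ∑ i ∈ s, Real.tanh (z i) ≤ d := by
    calc _ ≤ ∑ i ∈ s, (1 : ℝ) := Finset.sum_le_sum fun i _ => (Real.tanh_lt_one _).le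
      _ ≤ d := by simpa using (by exact_mod_cast hs : (s.card : ℝ) ≤ d)
  have h0 : 0 ≤ coshProd lam s z / √(1 + coshProd lam s z ^ 2) := by positivity
  calc _ ≤ coshProd lam s z / √(1 + coshProd lam s z ^ 2) * d := by gcongr
    _ ≤ 1 * d := by gcongr
    _ = d := one_mul _

/-! ### The partition function of induced subgraphs -/

section PartitionOn

variable {V : Type*} [DecidableEq V]

open Classical in
/-- The partition function of the subgraph of `G` induced on `S`. -/
def partitionOn (G : SimpleGraph V) (lam : ℝ) (S : Finset V) : ℝ :=
  ∑ I ∈ S.powerset.filter (fun J : Finset V => G.IsIndepSet (J : Set V)), lam ^ I.card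

open Classical in
/-- The members of `S` that are not adjacent to `v`. -/
def nonNeighbors (G : SimpleGraph V) (S : Finset V) (v : V) : Finset V :=
  S.filter fun w => ¬ G.Adj v w

/-- The occupation ratio of `v` in the subgraph induced on `insert v S`. -/
def occRatio (G : SimpleGraph V) (lam : ℝ) (S : Finset V) (v : V) : ℝ :=
  lam * partitionOn G lam (nonNeighbors G S v) / partitionOn G lam S

theorem indepPartition_eq_partitionOn [Fintype V] (G : SimpleGraph V) (lam : ℝ) :
    indepPartition G lam = partitionOn G lam Finset.univ := by
  rw [indepPartition, partitionOn, Finset.powerset_univ]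
  congr!

theorem partitionOn_empty (G : SimpleGraph V) (lam : ℝ) : partitionOn G lam ∅ = 1 := by
  classical
  simp [partitionOn, Finset.filter_singleton, SimpleGraph.IsIndepSet]

theorem partitionOn_pos (G : SimpleGraph V) {lam : ℝ} (hlam : 0 < lam) (S : Finset V) :
    0 < partitionOn G lam S := by
  classical
  refine Finset.sum_pos (fun I _ => pow_pos hlam _) ⟨∅, ?_⟩
  simp [SimpleGraph.IsIndepSet]

theorem partitionOn_mono (G : SimpleGraph V) {lam : ℝ} (hlam : 0 < lam) {S T : Finset V}
    (h : S ⊆ T) : partitionOn G lam S ≤ partitionOn G lam T := by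
  classical
  refine Finset.sum_le_sum_of_subset_of_nonneg ?_ fun I _ _ => (pow_pos hlam _).le
  exact Finset.filter_subset_filter _ (Finset.powerset_mono.2 h)

theorem partitionOn_insert (G : SimpleGraph V) (lam : ℝ) {S : Finset V} {v : V} (hv : v ∉ S) :
    partitionOn G lam (insert v S)
      = partitionOn G lam S + lam * partitionOn G lam (nonNeighbors G S v) := by
  classical
  unfold partitionOn
  rw [Finset.powerset_insert, Finset.filter_union, Finset.sum_union]
  · congr 1
    rw [Finset.filter_image, Finset.sum_image, Finset.mul_sum]
    · refine Finset.sum_congr ?_ ?_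
      · ext I
        simp only [Finset.mem_filter, Finset.mem_powerset, nonNeighbors]
        constructor
        · rintro ⟨h1, h2⟩
          refine ⟨fun w hw => Finset.mem_filter.2 ⟨h1 hw, ?_⟩, h2.mono (by simp)⟩
          exact h2 (by simp) (by simp [hw]) (by rintro rfl; exact hv (h1 hw))
        · rintro ⟨h1, h2⟩
          have h1' : ∀ w ∈ I, w ∈ S ∧ ¬ G.Adj v w := fun w hw => Finset.mem_filter.1 (h1 hw)
          refine ⟨fun w hw => (h1' w hw).1, ?_⟩
          rw [Finset.coe_insert]
          refine Set.Pairwise.insert h2 fun w hw _ => ?_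
          exact ⟨(h1' w hw).2, fun h => (h1' w hw).2 h.symm⟩
      · intro I hI
        simp only [Finset.mem_filter, Finset.mem_powerset] at hI
        rw [Finset.card_insert_of_notMem fun h => hv (Finset.mem_filter.1 (hI.1 h)).1, pow_succ']
    · intro I hI J hJ h
      simp only [Finset.coe_filter, Finset.mem_powerset, Set.mem_ofPred_eq] at hI hJ
      have h1 : v ∉ I := fun h => hv (hI.1 h)
      have h2 : v ∉ J := fun h => hv (hJ.1 h)
      rw [← Finset.erase_insert h1, ← Finset.erase_insert h2, h]
  · rw [Finset.disjoint_left]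
    intro I hI hI'
    simp only [Finset.mem_filter, Finset.mem_powerset, Finset.mem_image] at hI hI'
    obtain ⟨⟨J, -, rfl⟩, -⟩ := hI'
    exact hv (hI.1 (by simp))

theorem occRatio_pos (G : SimpleGraph V) {lam : ℝ} (hlam : 0 < lam) (S : Finset V) (v : V) :
    0 < occRatio G lam S v :=
  div_pos (mul_pos hlam (partitionOn_pos G hlam _)) (partitionOn_pos G hlam _)

theorem occRatio_le (G : SimpleGraph V) {lam : ℝ} (hlam : 0 < lam) (S : Finset V) (v : V) :
    occRatio G lam S v ≤ lam := by
  classical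
  unfold occRatio
  rw [div_le_iff₀ (partitionOn_pos G hlam _)]
  exact mul_le_mul_of_nonneg_left (partitionOn_mono G hlam (Finset.filter_subset _ _)) hlam.le

theorem partitionOn_insert_eq_mul (G : SimpleGraph V) {lam : ℝ} (hlam : 0 < lam) {S : Finset V}
    {v : V} (hv : v ∉ S) :
    partitionOn G lam (insert v S) = partitionOn G lam S * (1 + occRatio G lam S v) := by
  have := (partitionOn_pos G hlam S).ne'
  rw [partitionOn_insert G lam hv, occRatio]
  field_simp

theorem log_indepPartition_eq_sum {n : ℕ} (G : SimpleGraph (Fin n)) {lam : ℝ} (hlam : 0 < lam) :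
    Real.log (indepPartition G lam)
      = ∑ v : Fin n, Real.log (1 + occRatio G lam (Finset.univ.filter (v < ·)) v) := by
  have key : ∀ k ≤ n, Real.log (partitionOn G lam (Finset.univ.filter fun v : Fin n => n - k ≤ v))
      = ∑ v ∈ Finset.univ.filter (fun v : Fin n => n - k ≤ v),
        Real.log (1 + occRatio G lam (Finset.univ.filter (v < ·)) v) := by
    intro k
    induction k with
    | zero =>
      intro _
      have : (Finset.univ.filter fun v : Fin n => n - 0 ≤ v) = ∅ := by
        ext v
        simp
      rw [this]
      simp [partitionOn_empty]
    | succ k ih =>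
      intro hk
      let w : Fin n := ⟨n - (k + 1), by omega⟩
      have e1 : (Finset.univ.filter fun v : Fin n => n - k ≤ v) = Finset.univ.filter (w < ·) := by
        ext v
        simp only [Finset.mem_filter, Finset.mem_univ, true_and, Fin.lt_def, w]
        omega
      have e2 : (Finset.univ.filter fun v : Fin n => n - (k + 1) ≤ v)
          = insert w (Finset.univ.filter (w < ·)) := by
        ext v
        simp only [Finset.mem_filter, Finset.mem_univ, true_and, Finset.mem_insert, Fin.lt_def,
          Fin.ext_iff, w]
        omega
      have hw : w ∉ Finset.univ.filter (w < ·) := by simp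
      have hpos := occRatio_pos G hlam (Finset.univ.filter (w < ·)) w
      have ih' := ih (by omega)
      rw [e1] at ih'
      rw [e2, Finset.sum_insert hw, ← ih', partitionOn_insert_eq_mul G hlam hw, Real.log_mul
        (partitionOn_pos G hlam _).ne' (by linarith), add_comm]
  rw [indepPartition_eq_partitionOn]
  simpa using key n le_rfl

/-- The coordinate `arsinh √x` of the occupation ratio. -/
def occCoord (G : SimpleGraph V) (lam : ℝ) (S : Finset V) (v : V) : ℝ :=
  Real.arsinh √(occRatio G lam S v)

theorem occCoord_nonneg (G : SimpleGraph V) (lam : ℝ) (S : Finset V) (v : V) :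
    0 ≤ occCoord G lam S v :=
  Real.arsinh_nonneg_iff.2 (Real.sqrt_nonneg _)

theorem occCoord_le (G : SimpleGraph V) {lam : ℝ} (hlam : 0 < lam) (S : Finset V) (v : V) :
    occCoord G lam S v ≤ Real.arsinh √lam :=
  Real.arsinh_le_arsinh.2 (Real.sqrt_le_sqrt (occRatio_le G hlam S v))

theorem cosh_occCoord_sq (G : SimpleGraph V) {lam : ℝ} (hlam : 0 < lam) (S : Finset V) (v : V) :
    Real.cosh (occCoord G lam S v) ^ 2 = 1 + occRatio G lam S v := by
  rw [Real.cosh_sq, occCoord, Real.sinh_arsinh, Real.sq_sqrt (occRatio_pos G hlam S v).le, add_comm]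

/-- Telescoping over the deletion of `u 0, u 1, …`. Injectivity ensures that a vertex of `T` is
still present when its turn comes. -/
theorem partitionOn_eq_prod (G : SimpleGraph V) {lam : ℝ} (hlam : 0 < lam) (T : Finset V)
    (u : ℕ → V) (d : ℕ) (hu : Set.InjOn u (Set.Iio d)) :
    partitionOn G lam T = partitionOn G lam (T \ (Finset.range d).image u) *
      ∏ i ∈ (Finset.range d).filter (fun i => u i ∈ T),
        (1 + occRatio G lam (T \ (Finset.range (i + 1)).image u) (u i)) := by
  induction d with
  | zero => simp
  | succ d ih =>
    rw [ih (hu.mono (Set.Iio_subset_Iio (Nat.le_succ d))), Finset.range_add_one,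
      Finset.filter_insert]
    have e : T \ (insert d (Finset.range d)).image u
        = (T \ (Finset.range d).image u).erase (u d) := by
      rw [Finset.image_insert, Finset.sdiff_insert]
    split_ifs with h
    · have hmem : u d ∈ T \ (Finset.range d).image u := by
        simp only [Finset.mem_sdiff, Finset.mem_image, Finset.mem_range, not_exists, not_and]
        refine ⟨h, fun i hi hid => ?_⟩
        exact hi.ne (hu (Set.mem_Iio.2 (by omega)) (Set.mem_Iio.2 (by omega)) hid)
      rw [Finset.prod_insert (by simp), Finset.range_add_one, e, ← mul_assoc,
        ← partitionOn_insert_eq_mul G hlam (by simp), Finset.insert_erase hmem]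
    · rw [e, Finset.erase_eq_of_notMem fun h' => h (Finset.mem_sdiff.1 h').1]

/-- The tree recursion for occupation ratios, along a listing `u` of the neighbours of `v`. -/
theorem occCoord_eq (G : SimpleGraph V) {lam : ℝ} (hlam : 0 < lam) (T : Finset V) (v : V)
    (u : ℕ → V) (d : ℕ) (hu : Set.InjOn u (Set.Iio d))
    (hN : ∀ w, G.Adj v w ↔ ∃ i < d, u i = w) :
    occCoord G lam T v = Real.arsinh (coshProd lam ((Finset.range d).filter (fun i => u i ∈ T))
      fun i => occCoord G lam (T \ (Finset.range (i + 1)).image u) (u i)) := by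
  classical
  have hnon : nonNeighbors G T v = T \ (Finset.range d).image u := by
    ext w
    simp [nonNeighbors, hN]
  have hP := partitionOn_eq_prod G hlam T u d hu
  have h0 := (partitionOn_pos G hlam (T \ (Finset.range d).image u)).ne'
  have hprod : ∏ i ∈ (Finset.range d).filter (fun i => u i ∈ T),
      (1 + occRatio G lam (T \ (Finset.range (i + 1)).image u) (u i))
      = (∏ i ∈ (Finset.range d).filter (fun i => u i ∈ T),
        Real.cosh (occCoord G lam (T \ (Finset.range (i + 1)).image u) (u i))) ^ 2 := by
    rw [← Finset.prod_pow]
    exact Finset.prod_congr rfl fun i _ => (cosh_occCoord_sq G hlam _ _).symm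
  have hpos : 0 < ∏ i ∈ (Finset.range d).filter (fun i => u i ∈ T),
        Real.cosh (occCoord G lam (T \ (Finset.range (i + 1)).image u) (u i)) :=
    Finset.prod_pos fun i _ => Real.cosh_pos _
  have hρ : occRatio G lam T v = lam / (∏ i ∈ (Finset.range d).filter (fun i => u i ∈ T),
        Real.cosh (occCoord G lam (T \ (Finset.range (i + 1)).image u) (u i))) ^ 2 := by
    rw [← hprod, occRatio, hnon, hP]
    rw [hprod]
    field_simp
  rw [occCoord, hρ, Real.sqrt_div hlam.le, Real.sqrt_sq hpos.le, coshProd, Finset.prod_inv_distrib,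
    div_eq_mul_inv]

end PartitionOn

/-! ### Local exploration by query trees -/

namespace OracleGraph

variable {n : ℕ}

/-- The `i`-th neighbour of `v`, with the default value `v`. -/
def neighborD (G : OracleGraph n) (v : Fin n) (i : ℕ) : Fin n := (G.neighbor v i).getD v

theorem neighborD_eq (G : OracleGraph n) {v : Fin n} {i : ℕ} (h : i < G.degree v) :
    G.neighborD v i = G.neighbors v ⟨i, h⟩ := by
  unfold degree at h
  simp [neighborD, neighbor, h]

theorem neighborD_injOn (G : OracleGraph n) (v : Fin n) :
    Set.InjOn (G.neighborD v) (Set.Iio (G.degree v)) := by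
  intro i hi j hj h
  rw [G.neighborD_eq hi, G.neighborD_eq hj] at h
  exact congrArg Fin.val ((G.neighbors v).injective (Subtype.ext h))

theorem adj_iff_exists_neighborD (G : OracleGraph n) (v w : Fin n) :
    G.graph.Adj v w ↔ ∃ i < G.degree v, G.neighborD v i = w := by
  constructor
  · intro h
    let x : G.graph.neighborSet v := ⟨w, h⟩
    refine ⟨(G.neighbors v).symm x, ((G.neighbors v).symm x).2, ?_⟩
    rw [G.neighborD_eq ((G.neighbors v).symm x).2]
    simp [x]
  · rintro ⟨i, hi, rfl⟩
    rw [G.neighborD_eq hi]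
    exact (G.neighbors v ⟨i, hi⟩).2

end OracleGraph

namespace QueryTree

variable {n : ℕ}

/-- Sequential composition of query algorithms. -/
def bind (k : ℝ → QueryTree n) : QueryTree n → QueryTree n
  | ret x => k x
  | askDegree v next => askDegree v fun d => (next d).bind k
  | askNeighbor v i next => askNeighbor v i fun o => (next o).bind k

theorem output_bind (G : OracleGraph n) (k : ℝ → QueryTree n) (t : QueryTree n) :
    (t.bind k).output G = (k (t.output G)).output G := by
  induction t with
  | ret x => rfl
  | askDegree v next ih => exact ih _
  | askNeighbor v i next ih => exact ih _

theorem queries_bind (G : OracleGraph n) (k : ℝ → QueryTree n) (t : QueryTree n) :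
    (t.bind k).queries G = t.queries G + (k (t.output G)).queries G := by
  induction t with
  | ret x => simp [bind, queries, output]
  | askDegree v next ih => simp only [bind, queries, output, ih]; omega
  | askNeighbor v i next ih => simp only [bind, queries, output, ih]; omega

/-- Run `e` at each of the neighbours number `i, …, i + k - 1` of `v` that lie in `T`, removing
them from `T` one after the other, and combine the results by the tree recursion. -/
def exploreNeighbors (e : Finset (Fin n) → Fin n → QueryTree n) (v : Fin n) :
    ℕ → ℕ → Finset (Fin n) → ℝ → QueryTree n
  | 0, _, _, acc => ret (Real.arsinh acc)
  | k + 1, i, T, acc => askNeighbor v i fun o =>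
      if o.getD v ∈ T then
        (e (T.erase (o.getD v)) (o.getD v)).bind fun s =>
          exploreNeighbors e v k (i + 1) (T.erase (o.getD v)) (acc * (Real.cosh s)⁻¹)
      else exploreNeighbors e v k (i + 1) (T.erase (o.getD v)) acc

/-- The tree recursion truncated at depth `r`. -/
def explore (lam : ℝ) : ℕ → Finset (Fin n) → Fin n → QueryTree n
  | 0, _, _ => ret 0
  | r + 1, T, v => askDegree v fun d => exploreNeighbors (explore lam r) v d 0 T √lam

/-- The loop invariant: before neighbour `i` is treated, the current set is `T` without the
neighbours listed earlier. Erasing a vertex outside `T` changes nothing, so one formula for the set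
covers both branches. -/
theorem output_exploreNeighbors (G : OracleGraph n) (e : Finset (Fin n) → Fin n → QueryTree n)
    (v : Fin n) (T : Finset (Fin n)) (k i : ℕ) (acc : ℝ)
    (hu : Set.InjOn (G.neighborD v) (Set.Iio (i + k))) :
    (exploreNeighbors e v k i (T \ (Finset.range i).image (G.neighborD v)) acc).output G
      = Real.arsinh (acc * ∏ j ∈ Finset.Ico i (i + k), if G.neighborD v j ∈ T then
        (Real.cosh ((e (T \ (Finset.range (j + 1)).image (G.neighborD v))
          (G.neighborD v j)).output G))⁻¹ else 1) := by
  induction k generalizing i acc with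
  | zero => simp [exploreNeighbors, output]
  | succ k ih =>
    have hT : (T \ (Finset.range i).image (G.neighborD v)).erase (G.neighborD v i)
        = T \ (Finset.range (i + 1)).image (G.neighborD v) := by
      rw [Finset.range_add_one, Finset.image_insert, Finset.sdiff_insert]
    have hmem : G.neighborD v i ∈ T \ (Finset.range i).image (G.neighborD v)
        ↔ G.neighborD v i ∈ T := by
      simp only [Finset.mem_sdiff, Finset.mem_image, Finset.mem_range, not_exists, not_and,
        and_iff_left_iff_imp]
      intro _ j hj hji
      exact hj.ne (hu (Set.mem_Iio.2 (by omega)) (Set.mem_Iio.2 (by omega)) hji)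
    have ih' := fun acc => ih (i + 1) acc (hu.mono (Set.Iio_subset_Iio (by omega)))
    rw [exploreNeighbors, output, Finset.prod_eq_prod_Ico_succ_bot (by omega),
      show i + (k + 1) = i + 1 + k by omega]
    change (if G.neighborD v i ∈ T \ (Finset.range i).image (G.neighborD v) then
      (e ((T \ (Finset.range i).image (G.neighborD v)).erase (G.neighborD v i))
        (G.neighborD v i)).bind fun s => exploreNeighbors e v k (i + 1)
        ((T \ (Finset.range i).image (G.neighborD v)).erase (G.neighborD v i))
        (acc * (Real.cosh s)⁻¹)
      else exploreNeighbors e v k (i + 1)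
        ((T \ (Finset.range i).image (G.neighborD v)).erase (G.neighborD v i)) acc).output G = _
    simp only [hT, hmem]
    split_ifs with h
    · rw [output_bind, ih', mul_assoc]
    · rw [ih', one_mul]

theorem output_explore_succ (G : OracleGraph n) (lam : ℝ) (r : ℕ) (T : Finset (Fin n))
    (v : Fin n) :
    (explore lam (r + 1) T v).output G = Real.arsinh (coshProd lam
      ((Finset.range (G.degree v)).filter fun i => G.neighborD v i ∈ T) fun i =>
        (explore lam r (T \ (Finset.range (i + 1)).image (G.neighborD v))
          (G.neighborD v i)).output G) := by
  have h := output_exploreNeighbors G (explore lam r) v T (G.degree v) 0 √lam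
    (by simpa using G.neighborD_injOn v)
  simp only [Finset.range_zero, Finset.image_empty, Finset.sdiff_empty, zero_add] at h
  rw [explore, output, h, coshProd, Finset.prod_filter, Finset.range_eq_Ico]

theorem queries_exploreNeighbors_le (G : OracleGraph n)
    (e : Finset (Fin n) → Fin n → QueryTree n) (q : ℕ) (he : ∀ T v, (e T v).queries G ≤ q)
    (v : Fin n) (k i : ℕ) (T : Finset (Fin n)) (acc : ℝ) :
    (exploreNeighbors e v k i T acc).queries G ≤ k * (q + 1) := by
  induction k generalizing i T acc with
  | zero => simp [exploreNeighbors, queries]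
  | succ k ih =>
    rw [exploreNeighbors, queries, add_mul, one_mul]
    split_ifs with h
    · rw [queries_bind]
      have := he (T.erase ((G.neighbor v i).getD v)) ((G.neighbor v i).getD v)
      have := ih (i + 1) (T.erase ((G.neighbor v i).getD v)) (acc * (Real.cosh
        ((e (T.erase ((G.neighbor v i).getD v)) ((G.neighbor v i).getD v)).output G))⁻¹)
      omega
    · have := ih (i + 1) (T.erase ((G.neighbor v i).getD v)) acc
      omega

theorem queries_explore_lt (G : OracleGraph n) (lam : ℝ) {d : ℕ} (hG : G.MaxDegreeLE d) (r : ℕ)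
    (T : Finset (Fin n)) (v : Fin n) : (explore lam r T v).queries G < (d + 2) ^ r := by
  induction r generalizing T v with
  | zero => simp [explore, queries]
  | succ r ih =>
    have h1 := queries_exploreNeighbors_le G (explore lam r) ((d + 2) ^ r - 1)
      (fun T v => Nat.le_sub_one_of_lt (ih T v)) v (G.degree v) 0 T √lam
    have h0 : 0 < (d + 2) ^ r := by positivity
    have h2 : G.degree v * ((d + 2) ^ r - 1 + 1) ≤ d * (d + 2) ^ r := by
      rw [Nat.sub_add_cancel h0]
      exact Nat.mul_le_mul_right _ (hG v)
    rw [explore, queries, pow_succ]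
    nlinarith

theorem output_explore_nonneg (G : OracleGraph n) {lam : ℝ} (hlam : 0 < lam) (r : ℕ)
    (T : Finset (Fin n)) (v : Fin n) : 0 ≤ (explore lam r T v).output G := by
  cases r with
  | zero => simp [explore, output]
  | succ r =>
    rw [output_explore_succ]
    exact Real.arsinh_nonneg_iff.2 (coshProd_pos hlam _ _).le

theorem output_explore_le (G : OracleGraph n) {lam : ℝ} (r : ℕ)
    (T : Finset (Fin n)) (v : Fin n) : (explore lam r T v).output G ≤ Real.arsinh √lam := by
  cases r with
  | zero => simp [explore, output]
  | succ r =>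
    rw [output_explore_succ]
    refine Real.arsinh_le_arsinh.2 (mul_le_of_le_one_right (Real.sqrt_nonneg _) ?_)
    exact Finset.prod_le_one (fun i _ => inv_nonneg.2 (Real.cosh_pos _).le)
      fun i _ => inv_le_one_of_one_le₀ (Real.one_le_cosh _)

theorem output_explore_succ_sub_le (G : OracleGraph n) {lam : ℝ} (hlam : 0 < lam) {r : ℕ}
    {T : Finset (Fin n)} {v : Fin n} {K e : ℝ} (he : 0 ≤ e)
    (hK : ∀ z : ℕ → ℝ, coshProd lam
      ((Finset.range (G.degree v)).filter fun i => G.neighborD v i ∈ T) z / √(1 + coshProd lam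
      ((Finset.range (G.degree v)).filter fun i => G.neighborD v i ∈ T) z ^ 2) *
      ∑ i ∈ (Finset.range (G.degree v)).filter (fun i => G.neighborD v i ∈ T),
        Real.tanh (z i) ≤ K)
    (h : ∀ i < G.degree v, G.neighborD v i ∈ T →
      |(explore lam r (T \ (Finset.range (i + 1)).image (G.neighborD v))
          (G.neighborD v i)).output G - occCoord G.graph lam
          (T \ (Finset.range (i + 1)).image (G.neighborD v)) (G.neighborD v i)| ≤ e) :
    |(explore lam (r + 1) T v).output G - occCoord G.graph lam T v| ≤ K * e := by
  rw [output_explore_succ, occCoord_eq G.graph hlam T v (G.neighborD v) (G.degree v)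
    (G.neighborD_injOn v) (G.adj_iff_exists_neighborD v)]
  refine abs_arsinh_coshProd_sub_le hlam _ he hK _ _ (fun i _ => occCoord_nonneg _ _ _ _)
    (fun i _ => output_explore_nonneg G hlam _ _ _) fun i hi => ?_
  rw [Finset.mem_filter, Finset.mem_range] at hi
  exact h i hi.1 hi.2

/-- The neighbour outside `T` is the parent in the exploration; it leaves at most `Δ` children. The
condition is inherited, since `v` itself lies outside the sets passed to its children. -/
theorem output_explore_sub_le_of_neighbor (G : OracleGraph n) {Δ : ℕ} (hΔ : 2 ≤ Δ) {lam : ℝ}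
    (hlam : 0 < lam) (hlam' : lam < criticalActivity Δ) (hG : G.MaxDegreeLE (Δ + 1)) (r : ℕ)
    (T : Finset (Fin n)) (v : Fin n) (hv : v ∉ T) (hw : ∃ w, G.graph.Adj v w ∧ w ∉ T) :
    |(explore lam r T v).output G - occCoord G.graph lam T v|
      ≤ √(contractionSq Δ lam) ^ r * Real.arsinh √lam := by
  induction r generalizing T v with
  | zero =>
    rw [explore, output, zero_sub, abs_neg, abs_of_nonneg (occCoord_nonneg _ _ _ _), pow_zero,
      one_mul]
    exact occCoord_le _ hlam _ _
  | succ r ih =>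
    rw [pow_succ', mul_assoc]
    refine output_explore_succ_sub_le G hlam ?_ (contraction_bound hΔ hlam hlam' _ ?_) ?_
    · have := Real.arsinh_nonneg_iff.2 (Real.sqrt_nonneg lam)
      positivity
    · obtain ⟨w, hvw, hwT⟩ := hw
      obtain ⟨j, hj, rfl⟩ := (G.adj_iff_exists_neighborD v w).1 hvw
      have hlt : ((Finset.range (G.degree v)).filter fun i => G.neighborD v i ∈ T).card
          < (Finset.range (G.degree v)).card :=
        Finset.card_lt_card (Finset.filter_ssubset.2 ⟨j, Finset.mem_range.2 hj, hwT⟩)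
      rw [Finset.card_range] at hlt
      have := hG v
      omega
    · intro i hi hiT
      refine ih _ _
        (fun h => (Finset.mem_sdiff.1 h).2 (Finset.mem_image_of_mem _ (by simp)))
        ⟨v, ((G.adj_iff_exists_neighborD v _).2 ⟨i, hi, rfl⟩).symm, ?_⟩
      exact fun h => hv (Finset.mem_sdiff.1 h).1

theorem output_explore_succ_sub_occCoord_le (G : OracleGraph n) {Δ : ℕ} (hΔ : 2 ≤ Δ) {lam : ℝ}
    (hlam : 0 < lam) (hlam' : lam < criticalActivity Δ) (hG : G.MaxDegreeLE (Δ + 1)) (r : ℕ)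
    (T : Finset (Fin n)) (v : Fin n) (hv : v ∉ T) :
    |(explore lam (r + 1) T v).output G - occCoord G.graph lam T v|
      ≤ (Δ + 1 : ℕ) * (√(contractionSq Δ lam) ^ r * Real.arsinh √lam) := by
  refine output_explore_succ_sub_le G hlam ?_ (crude_bound hlam _ ?_) ?_
  · have := Real.arsinh_nonneg_iff.2 (Real.sqrt_nonneg lam)
    positivity
  · refine (Finset.card_filter_le _ _).trans ?_
    rw [Finset.card_range]
    exact hG v
  · intro i hi hiT
    refine output_explore_sub_le_of_neighbor G hΔ hlam hlam' hG r _ _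
      (fun h => (Finset.mem_sdiff.1 h).2 (Finset.mem_image_of_mem _ (by simp)))
      ⟨v, ((G.adj_iff_exists_neighborD v _).2 ⟨i, hi, rfl⟩).symm, ?_⟩
    exact fun h => hv (Finset.mem_sdiff.1 h).1

theorem log_cosh_le_add (a b : ℝ) :
    Real.log (Real.cosh a) ≤ |a - b| + Real.log (Real.cosh b) := by
  rw [← Real.log_exp |a - b|, ← Real.log_mul (Real.exp_pos _).ne' (Real.cosh_pos b).ne']
  apply Real.log_le_log (Real.cosh_pos a)
  have h1 : Real.exp a ≤ Real.exp |a - b| * Real.exp b := by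
    rw [← Real.exp_add]
    exact Real.exp_le_exp.2 (by linarith [le_abs_self (a - b)])
  have h2 : Real.exp (-a) ≤ Real.exp |a - b| * Real.exp (-b) := by
    rw [← Real.exp_add]
    exact Real.exp_le_exp.2 (by linarith [neg_le_abs (a - b)])
  rw [Real.cosh_eq, Real.cosh_eq]
  linarith

theorem abs_log_cosh_sub_le (a b : ℝ) :
    |Real.log (Real.cosh a) - Real.log (Real.cosh b)| ≤ |a - b| := by
  rw [abs_le]
  have h1 := log_cosh_le_add a b
  have h2 := log_cosh_le_add b a
  rw [abs_sub_comm] at h2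
  constructor <;> linarith

/-- The local estimate of the contribution of `v` to the logarithm of the partition function. -/
def localTerm (lam : ℝ) (r : ℕ) (v : Fin n) : QueryTree n :=
  (explore lam (r + 1) (Finset.univ.filter (v < ·)) v).bind fun s =>
    ret (2 * Real.log (Real.cosh s))

theorem output_localTerm (G : OracleGraph n) (lam : ℝ) (r : ℕ) (v : Fin n) :
    (localTerm lam r v).output G = 2 * Real.log (Real.cosh
      ((explore lam (r + 1) (Finset.univ.filter (v < ·)) v).output G)) := by
  rw [localTerm, output_bind, output]

theorem queries_localTerm_le (G : OracleGraph n) (lam : ℝ) {d : ℕ} (hG : G.MaxDegreeLE d) (r : ℕ)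
    (v : Fin n) : (localTerm lam r v).queries G ≤ (d + 2) ^ (r + 1) := by
  rw [localTerm, queries_bind, queries, add_zero]
  exact (queries_explore_lt G lam hG _ _ _).le

theorem output_localTerm_nonneg (G : OracleGraph n) (lam : ℝ) (r : ℕ) (v : Fin n) :
    0 ≤ (localTerm lam r v).output G := by
  rw [output_localTerm]
  exact mul_nonneg zero_le_two (Real.log_nonneg (Real.one_le_cosh _))

theorem output_localTerm_le (G : OracleGraph n) {lam : ℝ} (hlam : 0 < lam) (r : ℕ) (v : Fin n) :
    (localTerm lam r v).output G ≤ Real.log (1 + lam) := by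
  rw [output_localTerm]
  set s := (explore lam (r + 1) (Finset.univ.filter (v < ·)) v).output G
  have h0 : 0 ≤ s := output_explore_nonneg G hlam _ _ _
  have h1 : Real.sinh s ≤ √lam := by
    have := Real.sinh_le_sinh.2
      (output_explore_le G (lam := lam) (r + 1) (Finset.univ.filter (v < ·)) v)
    rwa [Real.sinh_arsinh] at this
  have h2 : Real.sinh s ^ 2 ≤ lam := by
    calc _ ≤ √lam ^ 2 := pow_le_pow_left₀ (Real.sinh_nonneg_iff.2 h0) h1 2
      _ = lam := Real.sq_sqrt hlam.le
  rw [← Nat.cast_two, ← Real.log_pow, Real.cosh_sq]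
  exact Real.log_le_log (by positivity) (by linarith)

theorem output_localTerm_sub_le (G : OracleGraph n) {Δ : ℕ} (hΔ : 2 ≤ Δ) {lam : ℝ}
    (hlam : 0 < lam) (hlam' : lam < criticalActivity Δ) (hG : G.MaxDegreeLE (Δ + 1)) (r : ℕ)
    (v : Fin n) :
    |(localTerm lam r v).output G
      - Real.log (1 + occRatio G.graph lam (Finset.univ.filter (v < ·)) v)|
      ≤ 2 * ((Δ + 1 : ℕ) * (√(contractionSq Δ lam) ^ r * Real.arsinh √lam)) := by
  rw [output_localTerm, ← cosh_occCoord_sq G.graph hlam, Real.log_pow, Nat.cast_two, ← mul_sub,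
    abs_mul, abs_two]
  refine mul_le_mul_of_nonneg_left ((abs_log_cosh_sub_le _ _).trans ?_) zero_le_two
  exact output_explore_succ_sub_occCoord_le G hΔ hlam hlam' hG r _ v (by simp)

/-- The sum of the outputs of `e` over a list. -/
def listSum (e : Fin n → QueryTree n) : List (Fin n) → QueryTree n
  | [] => ret 0
  | v :: l => (e v).bind fun x => (listSum e l).bind fun y => ret (x + y)

theorem output_listSum (G : OracleGraph n) (e : Fin n → QueryTree n) (l : List (Fin n)) :
    (listSum e l).output G = (l.map fun v => (e v).output G).sum := by
  induction l with
  | nil => rfl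
  | cons v l ih => simp [listSum, output_bind, output, ih]

theorem queries_listSum_le (G : OracleGraph n) (e : Fin n → QueryTree n) {q : ℕ}
    (he : ∀ v, (e v).queries G ≤ q) (l : List (Fin n)) :
    (listSum e l).queries G ≤ l.length * q := by
  induction l with
  | nil => simp [listSum, queries]
  | cons v l ih =>
    have := he v
    simp only [listSum, queries_bind, queries, List.length_cons, add_mul]
    omega

end QueryTree

/-! ### Estimating a sum by uniform samples -/

/-- The uniform distribution of `m` independent samples from `Fin n`. -/
def sampleMeasure (n m : ℕ) [NeZero n] : Measure (Fin m → Fin n) :=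
  Measure.pi fun _ => (PMF.uniformOfFintype (Fin n)).toMeasure

instance (n m : ℕ) [NeZero n] : IsProbabilityMeasure (sampleMeasure n m) :=
  inferInstanceAs (IsProbabilityMeasure (Measure.pi _))

theorem integral_uniformOfFintype_fin {n : ℕ} [NeZero n] (f : Fin n → ℝ) :
    ∫ v, f v ∂(PMF.uniformOfFintype (Fin n)).toMeasure = (∑ v, f v) / n := by
  rw [PMF.integral_eq_sum, Finset.sum_div]
  refine Finset.sum_congr rfl fun v _ => ?_
  simp [PMF.uniformOfFintype_apply, div_eq_inv_mul]

/-- Chebyshev's inequality; a variable with values in `[0, B]` has variance at most `B² / 4`. -/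
theorem sampleMeasure_deviation_le {n m : ℕ} [NeZero n] (hm : 0 < m) (f : Fin n → ℝ) {B t : ℝ}
    (ht : 0 < t) (h0 : ∀ v, 0 ≤ f v) (hB : ∀ v, f v ≤ B) :
    (sampleMeasure n m).real {x | t * n < |n / m * ∑ i, f (x i) - ∑ v, f v|}
      ≤ B ^ 2 / (4 * m * t ^ 2) := by
  have hn : (0 : ℝ) < n := by exact_mod_cast NeZero.pos n
  have hm' : (0 : ℝ) < m := by exact_mod_cast hm
  set P := (PMF.uniformOfFintype (Fin n)).toMeasure with hP
  have hmem : MemLp f 2 P := MemLp.of_bound (Measurable.of_discrete).aestronglyMeasurable B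
    (Filter.Eventually.of_forall fun v => by rw [Real.norm_of_nonneg (h0 v)]; exact hB v)
  set X : (Fin m → Fin n) → ℝ := ∑ i, fun x => f (x i) with hX
  have hXx : ∀ x, X x = ∑ i, f (x i) := fun x => by simp [hX]
  have hvar : ProbabilityTheory.variance X (sampleMeasure n m) ≤ m * (B / 2) ^ 2 := by
    rw [hX, sampleMeasure, ProbabilityTheory.variance_sum_pi (fun _ => hmem)]
    calc _ ≤ ∑ i : Fin m, ((B - 0) / 2) ^ 2 := Finset.sum_le_sum fun i _ =>
          ProbabilityTheory.variance_le_sq_of_bounded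
            (Filter.Eventually.of_forall fun v => ⟨h0 v, hB v⟩)
            (Measurable.of_discrete).aemeasurable
      _ = m * (B / 2) ^ 2 := by simp
  have hint : ∫ x, X x ∂(sampleMeasure n m) = m / n * ∑ v, f v := by
    simp_rw [hXx]
    rw [integral_finsetSum _ fun i _ => Integrable.of_finite]
    have : ∀ i : Fin m, ∫ x, f (x i) ∂(sampleMeasure n m) = (∑ v, f v) / n := fun i => by
      rw [sampleMeasure, integral_comp_eval (Measurable.of_discrete).aestronglyMeasurable,
        integral_uniformOfFintype_fin]
    simp only [this, Finset.sum_const, Finset.card_univ, Fintype.card_fin, nsmul_eq_mul]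
    ring
  have hXmem : MemLp X 2 (sampleMeasure n m) := memLp_finsetSum' _ fun i _ =>
    hmem.comp_measurePreserving (measurePreserving_eval _ i)
  have hc : 0 < m * t := by positivity
  have hcheb := ProbabilityTheory.meas_ge_le_variance_div_sq hXmem hc
  rw [hint] at hcheb
  have hsub : {x | t * n < |n / m * ∑ i, f (x i) - ∑ v, f v|}
      ⊆ {x | m * t ≤ |X x - m / n * ∑ v, f v|} := by
    intro x hx
    simp only [Set.mem_ofPred_eq] at hx ⊢
    have e : (n : ℝ) / m * ∑ i, f (x i) - ∑ v, f v = n / m * (X x - m / n * ∑ v, f v) := by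
      rw [hXx]
      field_simp
    rw [e, abs_mul, abs_of_pos (by positivity)] at hx
    have := mul_le_mul_of_nonneg_left hx.le (show (0 : ℝ) ≤ m / n by positivity)
    calc m * t = m / n * (t * n) := by field_simp
      _ ≤ _ := this
      _ = |X x - m / n * ∑ v, f v| := by field_simp
  calc _ ≤ (sampleMeasure n m).real {x | m * t ≤ |X x - m / n * ∑ v, f v|} :=
        measureReal_mono hsub
    _ ≤ ProbabilityTheory.variance X (sampleMeasure n m) / (m * t) ^ 2 :=
        ENNReal.toReal_le_of_le_ofReal
          (div_nonneg (ProbabilityTheory.variance_nonneg _ _) (sq_nonneg _)) hcheb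
    _ ≤ m * (B / 2) ^ 2 / (m * t) ^ 2 := by gcongr
    _ = B ^ 2 / (4 * m * t ^ 2) := by field_simp; ring

/-- The algorithm that averages the outputs of `e` over `m` uniform vertices. -/
def samplingAlg (n m : ℕ) [NeZero n] (e : Fin n → QueryTree n) : RandQueryAlg n where
  Ω := Fin m → Fin n
  μ := sampleMeasure n m
  tree x := (QueryTree.listSum e (List.ofFn x)).bind fun y => QueryTree.ret (n / m * y)
  measurable_output _ := Measurable.of_discrete
  measurable_queries _ := Measurable.of_discrete

theorem output_samplingAlg {n m : ℕ} [NeZero n] (e : Fin n → QueryTree n) (G : OracleGraph n)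
    (x : Fin m → Fin n) :
    ((samplingAlg n m e).tree x).output G = n / m * ∑ i, (e (x i)).output G := by
  change QueryTree.output G ((QueryTree.listSum e (List.ofFn x)).bind _) = _
  rw [QueryTree.output_bind, QueryTree.output, QueryTree.output_listSum, List.map_ofFn,
    List.sum_ofFn]
  rfl

theorem queries_samplingAlg_le {n m : ℕ} [NeZero n] (e : Fin n → QueryTree n) (G : OracleGraph n)
    {q : ℕ} (he : ∀ v, (e v).queries G ≤ q) (x : Fin m → Fin n) :
    ((samplingAlg n m e).tree x).queries G ≤ m * q := by
  change QueryTree.queries G ((QueryTree.listSum e (List.ofFn x)).bind _) ≤ _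
  rw [QueryTree.queries_bind, QueryTree.queries, add_zero]
  simpa using QueryTree.queries_listSum_le G e he (List.ofFn x)

/-- Half of the error budget pays for the bias of the local terms, the other half for sampling. -/
theorem samplingAlg_isApproximation {n m : ℕ} [NeZero n] (e : Fin n → QueryTree n) {d : ℕ}
    {val : SimpleGraph (Fin n) → ℝ} {ε B : ℝ} (hε : 0 < ε) (hm : 3 * B ^ 2 / ε ^ 2 ≤ m)
    (hm0 : 0 < m) (term : SimpleGraph (Fin n) → Fin n → ℝ) (hval : ∀ G, val G = ∑ v, term G v)
    (h0 : ∀ G v, 0 ≤ (e v).output G) (hB : ∀ G v, (e v).output G ≤ B)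
    (herr : ∀ G : OracleGraph n, G.MaxDegreeLE d →
      ∀ v, |(e v).output G - term G.graph v| ≤ ε / 2) :
    (samplingAlg n m e).IsApproximation d val (ε * n) := by
  intro G hG
  have hm' : (0 : ℝ) < m := by exact_mod_cast hm0
  have hdev := sampleMeasure_deviation_le hm0 (fun v => (e v).output G) (half_pos hε) (h0 G) (hB G)
  have hsum : |∑ v, (e v).output G - val G.graph| ≤ ε / 2 * n := by
    rw [hval, ← Finset.sum_sub_distrib]
    refine (Finset.abs_sum_le_sum_abs _ _).trans
      ((Finset.sum_le_sum fun v _ => herr G hG v).trans ?_)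
    simp [mul_comm]
  have hthird : B ^ 2 / (4 * m * (ε / 2) ^ 2) ≤ 1 / 3 := by
    rw [div_le_div_iff₀ (by positivity) (by norm_num)]
    rw [div_le_iff₀ (by positivity)] at hm
    nlinarith
  set S : Set (Fin m → Fin n) := {x | ε / 2 * n <
    |n / m * ∑ i, (e (x i)).output G - ∑ v, (e v).output G|} with hS
  have hcompl := probReal_compl_eq_one_sub (μ := sampleMeasure n m)
    (show MeasurableSet S from MeasurableSet.of_discrete)
  calc (2 : ℝ) / 3 ≤ (sampleMeasure n m).real Sᶜ := by rw [hcompl]; linarith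
    _ ≤ _ := by
      refine measureReal_mono fun x hx => ?_
      rw [Set.mem_compl_iff, hS, Set.mem_ofPred_eq, not_lt] at hx
      change |((samplingAlg n m e).tree x).output G - val G.graph| ≤ ε * n
      rw [output_samplingAlg]
      have := abs_sub_le ((n : ℝ) / m * ∑ i, (e (x i)).output G) (∑ v, (e v).output G)
        (val G.graph)
      linarith

/-- The algorithm that makes no queries and returns `x`. -/
def constAlg (n : ℕ) (x : ℝ) : RandQueryAlg n where
  Ω := Unit
  μ := Measure.dirac ()
  tree _ := QueryTree.ret x
  measurable_output _ := measurable_const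
  measurable_queries _ := measurable_const

/-- Take `r` minimal: then `κ ^ (r - 1)` still exceeds `ε / C`, and `D ≤ κ ^ (-a)` turns this into a
polynomial bound on `D ^ (r - 1)`. This is why logarithmic depth costs polynomially many queries. -/
theorem exists_pow_lt_and_le {κ : ℝ} (hκ0 : 0 < κ) (hκ1 : κ < 1) {D : ℕ} (hD : 0 < D) {C : ℝ}
    (hC : 0 < C) : ∃ a : ℕ, ∀ ε : ℝ, 0 < ε → ∃ r : ℕ, C * κ ^ r ≤ ε ∧
      ((D : ℝ) ^ r ≤ D * (1 + (C / ε) ^ a)) := by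
  classical
  have hD' : (1 : ℝ) ≤ D := by exact_mod_cast hD
  obtain ⟨a, ha⟩ := exists_pow_lt_of_lt_one (show (0 : ℝ) < 1 / D by positivity) hκ1
  have ha' : (D : ℝ) ≤ (1 / κ) ^ a := by
    rw [one_div_pow, le_div_iff₀ (by positivity)]
    rw [lt_div_iff₀ (by positivity)] at ha
    linarith
  refine ⟨a, fun ε hε => ?_⟩
  have hex : ∃ r : ℕ, C * κ ^ r ≤ ε := by
    obtain ⟨r, hr⟩ := exists_pow_lt_of_lt_one (show (0 : ℝ) < ε / C by positivity) hκ1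
    rw [lt_div_iff₀ hC] at hr
    exact ⟨r, by linarith⟩
  refine ⟨Nat.find hex, Nat.find_spec hex, ?_⟩
  have hp : 0 ≤ (C / ε) ^ a := by positivity
  rcases h : Nat.find hex with _ | s
  · rw [pow_zero]
    nlinarith
  · have hs := Nat.find_min hex (m := s) (by omega)
    rw [not_le] at hs
    have h1 : (1 / κ) ^ s ≤ C / ε := by
      rw [one_div_pow, div_le_div_iff₀ (by positivity) hε]
      linarith
    rw [pow_succ, mul_comm]
    refine mul_le_mul_of_nonneg_left ?_ (by linarith)
    calc (D : ℝ) ^ s ≤ ((1 / κ) ^ a) ^ s := by gcongr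
      _ = ((1 / κ) ^ s) ^ a := by rw [← pow_mul, ← pow_mul, mul_comm]
      _ ≤ (C / ε) ^ a := by gcongr
      _ ≤ _ := by linarith

theorem exists_samplingAlg (Δ : ℕ) (hΔ : 2 ≤ Δ) (lam : ℝ) (hlam : 0 < lam)
    (hlam' : lam < criticalActivity Δ) :
    ∃ (A : (n : ℕ) → ℝ → RandQueryAlg n) (P : Polynomial ℝ),
      ∀ (n : ℕ) (ε : ℝ), 0 < ε →
        (A n ε).IsApproximation (Δ + 1) (fun G => Real.log (indepPartition G lam)) (ε * n) ∧
        ∀ G : OracleGraph n, G.MaxDegreeLE (Δ + 1) →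
          ∀ ω : (A n ε).Ω, (((A n ε).tree ω).queries G : ℝ) ≤ P.eval (1 / ε) := by
  set κ := √(contractionSq Δ lam) with hκ
  have hκ0 : 0 < κ := Real.sqrt_pos.2 (contractionSq_pos hΔ hlam)
  have hκ1 : κ < 1 := by
    rw [hκ, Real.sqrt_lt' one_pos, one_pow]
    exact contractionSq_lt_one hΔ hlam hlam'
  -- One factor 2 comes from `log (1 + x) = 2 log (cosh s)`, the other from the target error `ε /
  -- 2`.
  set C := 4 * ((Δ + 1 : ℕ) * Real.arsinh √lam) with hC
  have hC0 : 0 < C := by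
    have := Real.arsinh_pos_iff.2 (Real.sqrt_pos.2 hlam)
    positivity
  set D := Δ + 1 + 2 with hD
  obtain ⟨a, ha⟩ := exists_pow_lt_and_le hκ0 hκ1 (show 0 < D by omega) hC0
  choose! r hr1 hr2 using ha
  set B := Real.log (1 + lam) with hB
  set P : Polynomial ℝ := (Polynomial.C (3 * B ^ 2) * Polynomial.X ^ 2 + 2) *
    (Polynomial.C (D ^ 2 : ℝ) * (1 + (Polynomial.C C * Polynomial.X) ^ a)) with hP
  have hPeval : ∀ x, P.eval x = (3 * B ^ 2 * x ^ 2 + 2) * (D ^ 2 * (1 + (C * x) ^ a)) := by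
    intro x
    simp [hP]
  suffices ∀ (n : ℕ) (ε : ℝ), ∃ A : RandQueryAlg n, 0 < ε →
      A.IsApproximation (Δ + 1) (fun G => Real.log (indepPartition G lam)) (ε * n) ∧
        ∀ G : OracleGraph n, G.MaxDegreeLE (Δ + 1) →
          ∀ ω : A.Ω, ((A.tree ω).queries G : ℝ) ≤ P.eval (1 / ε) by
    choose A hA using this
    exact ⟨A, P, hA⟩
  intro n ε
  rcases Nat.eq_zero_or_pos n with rfl | hn
  -- Without vertices there is nothing to sample, and `log Z = 0`.
  · refine ⟨constAlg 0 0, fun hε => ⟨fun G _ => ?_, fun G _ ω => ?_⟩⟩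
    · have h : Real.log (indepPartition G.graph lam) = 0 := by
        rw [log_indepPartition_eq_sum _ hlam]
        simp
      have e : {ω | |((constAlg 0 0).tree ω).output G - Real.log (indepPartition G.graph lam)|
          ≤ ε * (0 : ℕ)} = Set.univ := by
        ext ω
        simp [h, constAlg, QueryTree.output]
      rw [e, probReal_univ]
      norm_num
    · rw [hPeval]
      have : (((constAlg 0 0).tree ω).queries G : ℝ) = 0 := by
        simp [constAlg, QueryTree.queries]
      rw [this]
      positivity
  · have : NeZero n := ⟨hn.ne'⟩
    refine ⟨samplingAlg n (⌈3 * B ^ 2 / ε ^ 2⌉₊ + 1) (QueryTree.localTerm lam (r ε)),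
      fun hε => ⟨?_, fun G hG ω => ?_⟩⟩
    · refine samplingAlg_isApproximation (B := B) _ hε ?_ (Nat.succ_pos _) (fun G v =>
        Real.log (1 + occRatio G lam (Finset.univ.filter (v < ·)) v))
        (fun G => log_indepPartition_eq_sum G hlam)
        (fun G v => QueryTree.output_localTerm_nonneg G lam _ v)
        (fun G v => QueryTree.output_localTerm_le G hlam _ v) fun G hG v => ?_
      · push_cast
        linarith [Nat.le_ceil (3 * B ^ 2 / ε ^ 2)]
      · refine (QueryTree.output_localTerm_sub_le G hΔ hlam hlam' hG (r ε) v).trans ?_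
        have := hr1 ε hε
        rw [hC] at this
        linarith
    · have h1 := queries_samplingAlg_le (m := ⌈3 * B ^ 2 / ε ^ 2⌉₊ + 1) _ G
        (QueryTree.queries_localTerm_le G lam hG (r ε)) ω
      have h2 : (⌈3 * B ^ 2 / ε ^ 2⌉₊ : ℝ) ≤ 3 * B ^ 2 / ε ^ 2 + 1 :=
        (Nat.ceil_lt_add_one (by positivity)).le
      have h3 := hr2 ε hε
      rw [hPeval]
      calc _ ≤ (((⌈3 * B ^ 2 / ε ^ 2⌉₊ + 1) * D ^ (r ε + 1) : ℕ) : ℝ) := by exact_mod_cast h1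
        _ = ((⌈3 * B ^ 2 / ε ^ 2⌉₊ : ℝ) + 1) * (D * (D : ℝ) ^ r ε) := by push_cast; ring
        _ ≤ (3 * B ^ 2 / ε ^ 2 + 1 + 1) * (D * (D * (1 + (C / ε) ^ a))) := by gcongr
        _ = _ := by rw [mul_one_div]; ring

/-! ### Random bits and the Hellinger affinity of acceptance probabilities -/

section Bits

variable {ι : Type*} [Fintype ι] [DecidableEq ι]

/-- The weight of the value `x` of a bit that is fixed, or else is `true` with probability `p`. -/
def bitWeight (p : ℝ) : Option Bool → Bool → ℝ
  | none, x => if x then p else 1 - p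
  | some y, x => if x = y then 1 else 0

/-- The expectation of `f` over independent bits, those recorded in `σ` being fixed and the others
being `true` with probability `p`. -/
def bitExp (p : ℝ) (σ : ι → Option Bool) (f : (ι → Bool) → ℝ) : ℝ :=
  ∑ b, (∏ j, bitWeight p (σ j) (b j)) * f b

theorem bitWeight_nonneg {p : ℝ} (h0 : 0 ≤ p) (h1 : p ≤ 1) (o : Option Bool) (x : Bool) :
    0 ≤ bitWeight p o x := by
  cases o <;> simp only [bitWeight] <;> split_ifs <;> linarith

theorem bitExp_prod (p : ℝ) (σ : ι → Option Bool) (g : ι → Bool → ℝ) :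
    bitExp p σ (fun b => ∏ j, g j (b j))
      = ∏ j, (bitWeight p (σ j) true * g j true + bitWeight p (σ j) false * g j false) := by
  have h := (Finset.prod_univ_sum (fun _ : ι => (Finset.univ : Finset Bool))
    fun j x => bitWeight p (σ j) x * g j x).symm
  rw [Fintype.piFinset_univ] at h
  simp only [Fintype.sum_bool] at h
  rw [← h, bitExp]
  exact Finset.sum_congr rfl fun b _ => Finset.prod_mul_distrib.symm

theorem bitExp_const (p : ℝ) (σ : ι → Option Bool) (c : ℝ) : bitExp p σ (fun _ => c) = c := by
  have h := bitExp_prod p σ fun _ _ => 1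
  have h1 : bitExp p σ (fun _ => 1) = 1 := by
    simp only [Finset.prod_const_one, mul_one] at h
    rw [h]
    refine Finset.prod_eq_one fun j _ => ?_
    cases hj : σ j with
    | none => simp [bitWeight]
    | some y => cases y <;> simp [bitWeight]
  simp only [bitExp, mul_one] at h1
  rw [bitExp, ← Finset.sum_mul, h1, one_mul]

theorem bitExp_add (p : ℝ) (σ : ι → Option Bool) (f g : (ι → Bool) → ℝ) :
    bitExp p σ (fun b => f b + g b) = bitExp p σ f + bitExp p σ g := by
  simp only [bitExp, mul_add, Finset.sum_add_distrib]

theorem bitExp_sub (p : ℝ) (σ : ι → Option Bool) (f g : (ι → Bool) → ℝ) :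
    bitExp p σ (fun b => f b - g b) = bitExp p σ f - bitExp p σ g := by
  simp only [bitExp, mul_sub, Finset.sum_sub_distrib]

theorem bitExp_sum {κ : Type*} (p : ℝ) (σ : ι → Option Bool) (s : Finset κ)
    (f : κ → (ι → Bool) → ℝ) :
    bitExp p σ (fun b => ∑ k ∈ s, f k b) = ∑ k ∈ s, bitExp p σ (f k) := by
  simp only [bitExp, Finset.mul_sum]
  exact Finset.sum_comm

theorem bitExp_mono {p : ℝ} (h0 : 0 ≤ p) (h1 : p ≤ 1) (σ : ι → Option Bool)
    {f g : (ι → Bool) → ℝ} (h : ∀ b, f b ≤ g b) : bitExp p σ f ≤ bitExp p σ g :=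
  Finset.sum_le_sum fun b _ => mul_le_mul_of_nonneg_left (h b)
    (Finset.prod_nonneg fun _ _ => bitWeight_nonneg h0 h1 _ _)

theorem bitExp_mem_Icc {p : ℝ} (h0 : 0 ≤ p) (h1 : p ≤ 1) (σ : ι → Option Bool)
    {f : (ι → Bool) → ℝ} (hf : ∀ b, f b ∈ Set.Icc (0 : ℝ) 1) : bitExp p σ f ∈ Set.Icc (0 : ℝ) 1 :=
  ⟨(bitExp_const p σ 0).symm.trans_le (bitExp_mono h0 h1 σ fun b => (hf b).1),
    (bitExp_mono h0 h1 σ fun b => (hf b).2).trans_eq (bitExp_const p σ 1)⟩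

theorem bitExp_congr_of_some (p : ℝ) {σ : ι → Option Bool} {j : ι} {x : Bool} (hj : σ j = some x)
    {f g : (ι → Bool) → ℝ} (h : ∀ b, b j = x → f b = g b) : bitExp p σ f = bitExp p σ g := by
  refine Finset.sum_congr rfl fun b _ => ?_
  by_cases hb : b j = x
  · rw [h b hb]
  · rw [Finset.prod_eq_zero (Finset.mem_univ j) (by rw [hj]; simp [bitWeight, hb]), zero_mul,
      zero_mul]

theorem bitExp_split (p : ℝ) {σ : ι → Option Bool} {j : ι} (hj : σ j = none)
    (f : (ι → Bool) → ℝ) :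
    bitExp p σ f = p * bitExp p (Function.update σ j (some true)) f
      + (1 - p) * bitExp p (Function.update σ j (some false)) f := by
  simp only [bitExp, Finset.mul_sum, ← Finset.sum_add_distrib]
  refine Finset.sum_congr rfl fun b _ => ?_
  have key : ∀ τ : ι → Option Bool, (∀ i ≠ j, τ i = σ i) → ∏ i, bitWeight p (τ i) (b i)
      = bitWeight p (τ j) (b j) * ∏ i ∈ Finset.univ.erase j, bitWeight p (σ i) (b i) := by
    intro τ hτ
    rw [← Finset.mul_prod_erase _ _ (Finset.mem_univ j)]
    congr 1
    exact Finset.prod_congr rfl fun i hi => by rw [hτ i (Finset.ne_of_mem_erase hi)]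
  rw [key σ fun _ _ => rfl, key _ fun i hi => Function.update_of_ne hi _ _,
    key (Function.update σ j (some false)) fun i hi => Function.update_of_ne hi _ _,
    Function.update_self, Function.update_self, hj]
  cases b j <;> simp [bitWeight] <;> ring

theorem bitExp_sq_sum_le {p : ℝ} (E : Finset ι) :
    bitExp p (fun _ => none) (fun b => (∑ v ∈ E, ((if b v then 1 else 0) - p)) ^ 2)
      ≤ E.card / 4 := by
  set y : Bool → ℝ := fun x => (if x then 1 else 0) - p with hy
  have hpair : ∀ v w : ι, bitExp p (fun _ => none) (fun b => y (b v) * y (b w))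
      ≤ if v = w then 1 / 4 else 0 := by
    intro v w
    -- The two factors are written as a product over all bits, so that independence applies:
    -- off-diagonal terms vanish and diagonal ones equal `p * (1 - p) ≤ 1 / 4`.
    have h := bitExp_prod p (fun _ : ι => none) fun j x =>
      (if j = v then y x else 1) * (if j = w then y x else 1)
    simp only [Finset.prod_mul_distrib, Finset.prod_ite_eq', Finset.mem_univ, if_true] at h
    rw [h]
    split_ifs with hvw
    · subst hvw
      rw [← Finset.mul_prod_erase _ _ (Finset.mem_univ v), Finset.prod_eq_one]
      · simp only [if_true, bitWeight, hy]
        simp only [Bool.false_eq_true, if_false]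
        nlinarith [sq_nonneg (p - 1 / 2)]
      · intro j hj
        simp [Finset.ne_of_mem_erase hj, bitWeight]
    · refine (Finset.prod_eq_zero (Finset.mem_univ v) ?_).le
      simp only [if_true, if_neg hvw, bitWeight, hy]
      simp only [Bool.false_eq_true, if_false]
      ring
  simp only [sq, Finset.sum_mul_sum]
  rw [bitExp_sum]
  simp only [bitExp_sum]
  calc _ ≤ ∑ v ∈ E, ∑ w ∈ E, (if v = w then (1 / 4 : ℝ) else 0) :=
        Finset.sum_le_sum fun v _ => Finset.sum_le_sum fun w _ => hpair v w
    _ = E.card / 4 := by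
        rw [Finset.sum_congr rfl fun v hv => by rw [Finset.sum_ite_eq, if_pos hv]]
        simp
        ring

open Classical in
theorem bitExp_deviation_le {p t : ℝ} (h0 : 0 ≤ p) (h1 : p ≤ 1) (ht : 0 < t) (E : Finset ι) :
    bitExp p (fun _ => none) (fun b =>
      if t ≤ |∑ v ∈ E, ((if b v then 1 else 0) - p)| then 1 else 0) ≤ E.card / (4 * t ^ 2) := by
  rw [← div_div, le_div_iff₀ (by positivity), ← sub_nonneg]
  have h := bitExp_sq_sum_le (p := p) E
  have hle : bitExp p (fun _ => none) (fun b =>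
      (if t ≤ |∑ v ∈ E, ((if b v then 1 else 0) - p)| then (1 : ℝ) else 0) * t ^ 2)
      ≤ bitExp p (fun _ => none) (fun b => (∑ v ∈ E, ((if b v then 1 else 0) - p)) ^ 2) := by
    refine bitExp_mono h0 h1 _ fun b => ?_
    split_ifs with hb
    · rw [one_mul, ← sq_abs (∑ v ∈ E, _)]
      exact pow_le_pow_left₀ ht.le hb 2
    · rw [zero_mul]
      exact sq_nonneg _
  have e : bitExp p (fun _ => none) (fun b =>
      (if t ≤ |∑ v ∈ E, ((if b v then 1 else 0) - p)| then (1 : ℝ) else 0) * t ^ 2)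
      = bitExp p (fun _ => none) (fun b =>
        if t ≤ |∑ v ∈ E, ((if b v then 1 else 0) - p)| then (1 : ℝ) else 0) * t ^ 2 := by
    simp only [bitExp, Finset.sum_mul, mul_assoc]
  linarith

end Bits

theorem sqrt_mul_add_sqrt_mul_le {x y z w : ℝ} (hx : 0 ≤ x) (hy : 0 ≤ y) (hz : 0 ≤ z)
    (hw : 0 ≤ w) : √(x * z) + √(y * w) ≤ √((x + y) * (z + w)) := by
  apply Real.le_sqrt_of_sq_le
  rw [add_sq, Real.sq_sqrt (by positivity), Real.sq_sqrt (by positivity), mul_assoc,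
    ← Real.sqrt_mul (by positivity)]
  have h : √(x * z * (y * w)) ≤ (x * w + y * z) / 2 := by
    rw [Real.sqrt_le_left (by positivity)]
    nlinarith [sq_nonneg (x * w - y * z)]
  linarith

/-- The Hellinger affinity of two Bernoulli distributions. -/
def affinity (a b : ℝ) : ℝ := √(a * b) + √((1 - a) * (1 - b))

/-- Cauchy-Schwarz over the value of the revealed bit. Since the biases `p` and `q` are swapped,
both values receive the same weight `√(p * q)`; hence query counts are averaged over fair bits. -/
theorem affinity_mix {p q a₁ a₀ b₁ b₀ : ℝ} (hp : 0 ≤ p) (hq : 0 ≤ q) (hpq : p + q = 1)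
    (ha₁ : a₁ ∈ Set.Icc (0 : ℝ) 1) (ha₀ : a₀ ∈ Set.Icc (0 : ℝ) 1) (hb₁ : b₁ ∈ Set.Icc (0 : ℝ) 1)
    (hb₀ : b₀ ∈ Set.Icc (0 : ℝ) 1) :
    √(p * q) * (affinity a₁ b₁ + affinity a₀ b₀)
      ≤ affinity (p * a₁ + q * a₀) (q * b₁ + p * b₀) := by
  have key : ∀ {x₁ x₀ y₁ y₀ : ℝ}, 0 ≤ x₁ → 0 ≤ x₀ → 0 ≤ y₁ → 0 ≤ y₀ →
      √(p * q) * √(x₁ * y₁) + √(p * q) * √(x₀ * y₀)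
        ≤ √((p * x₁ + q * x₀) * (q * y₁ + p * y₀)) := by
    intro x₁ x₀ y₁ y₀ hx₁ hx₀ hy₁ hy₀
    rw [← Real.sqrt_mul (by positivity), ← Real.sqrt_mul (by positivity),
      show p * q * (x₁ * y₁) = p * x₁ * (q * y₁) by ring,
      show p * q * (x₀ * y₀) = q * x₀ * (p * y₀) by ring]
    exact sqrt_mul_add_sqrt_mul_le (by positivity) (by positivity) (by positivity) (by positivity)
  have h1 := key ha₁.1 ha₀.1 hb₁.1 hb₀.1
  have h2 := key (sub_nonneg.2 ha₁.2) (sub_nonneg.2 ha₀.2) (sub_nonneg.2 hb₁.2)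
    (sub_nonneg.2 hb₀.2)
  have e1 : 1 - (p * a₁ + q * a₀) = p * (1 - a₁) + q * (1 - a₀) := by linear_combination -hpq
  have e2 : 1 - (q * b₁ + p * b₀) = q * (1 - b₁) + p * (1 - b₀) := by linear_combination -hpq
  unfold affinity
  rw [e1, e2]
  linarith

/-- `2 * (1 - affinity a b)` is `(√a - √b)² + (√(1 - a) - √(1 - b))²`, and `(√a + √b)² ≤ 4`. -/
theorem sq_sub_le_of_affinity {a b : ℝ} (ha : a ∈ Set.Icc (0 : ℝ) 1) (hb : b ∈ Set.Icc (0 : ℝ) 1) :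
    (a - b) ^ 2 ≤ 8 * (1 - affinity a b) := by
  have ha' := sub_nonneg.2 ha.2
  have hb' := sub_nonneg.2 hb.2
  unfold affinity
  rw [Real.sqrt_mul ha.1, Real.sqrt_mul ha']
  have s1 := Real.sq_sqrt ha.1
  have s2 := Real.sq_sqrt hb.1
  have s3 := Real.sq_sqrt ha'
  have s4 := Real.sq_sqrt hb'
  have h1 : √a ≤ 1 := Real.sqrt_le_one.2 ha.2
  have h2 : √b ≤ 1 := Real.sqrt_le_one.2 hb.2
  have h3 : (a - b) ^ 2 = (√a - √b) ^ 2 * (√a + √b) ^ 2 := by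
    rw [← mul_pow]
    congr 1
    linear_combination s2 - s1
  have h4 : (√a + √b) ^ 2 ≤ 4 := by nlinarith [Real.sqrt_nonneg a, Real.sqrt_nonneg b]
  have h5 := mul_le_mul_of_nonneg_left h4 (sq_nonneg (√a - √b))
  have h6 := sq_nonneg (√(1 - a) - √(1 - b))
  nlinarith

section Indistinguishability

variable {n : ℕ} {ι : Type*} [Fintype ι] [DecidableEq ι]

/-- The oracle answers at each vertex `v` of the graphs `G b` are determined by the bit `π v`. -/
def AnswersLocally (G : (ι → Bool) → OracleGraph n) (π : Fin n → ι) : Prop :=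
  ∀ v b b', b (π v) = b' (π v) →
    (G b).degree v = (G b').degree v ∧ ∀ i, (G b).neighbor v i = (G b').neighbor v i

/-- The affinity bound for a query tree whose input graph is encoded by random bits. -/
def AffinityBound (G : (ι → Bool) → OracleGraph n) (F : ℝ → ℝ) (δ : ℝ) (t : QueryTree n)
    (σ : ι → Option Bool) : Prop :=
  1 - (1 - √(1 - 4 * δ ^ 2)) * bitExp (1 / 2) σ (fun b => (t.queries (G b) : ℝ))
    ≤ affinity (bitExp (1 / 2 + δ) σ fun b => F (t.output (G b)))
      (bitExp (1 / 2 - δ) σ fun b => F (t.output (G b)))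

/-- One query, answered by bit `j`. A fresh bit multiplies the averaged affinity by at least `θ`, a
loss covered by the extra query; a bit already fixed in `σ` reveals nothing new. -/
theorem affinityBound_step {G : (ι → Bool) → OracleGraph n} {F : ℝ → ℝ}
    (hF : ∀ x, F x ∈ Set.Icc (0 : ℝ) 1) {δ : ℝ} (hδ0 : 0 ≤ δ) (hδ : δ ≤ 1 / 2) (j : ι)
    (t : QueryTree n) (T : Bool → QueryTree n)
    (hout : ∀ b, t.output (G b) = (T (b j)).output (G b))
    (hq : ∀ b, t.queries (G b) = (T (b j)).queries (G b) + 1)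
    (ih : ∀ x σ, AffinityBound G F δ (T x) σ) (σ : ι → Option Bool) :
    AffinityBound G F δ t σ := by
  set θ := √(1 - 4 * δ ^ 2) with hθ
  have hθ1 : θ ≤ 1 := Real.sqrt_le_one.2 (by nlinarith)
  have hF' : ∀ (p : ℝ) (τ : ι → Option Bool) (x : Bool), τ j = some x →
      bitExp p τ (fun b => F (t.output (G b))) = bitExp p τ fun b => F ((T x).output (G b)) :=
    fun p τ x hτ => bitExp_congr_of_some p hτ fun b hb => by rw [hout, hb]
  have hq' : ∀ (p : ℝ) (τ : ι → Option Bool) (x : Bool), τ j = some x →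
      bitExp p τ (fun b => (t.queries (G b) : ℝ))
        = bitExp p τ (fun b => ((T x).queries (G b) : ℝ)) + 1 := by
    intro p τ x hτ
    rw [bitExp_congr_of_some p hτ (g := fun b => ((T x).queries (G b) : ℝ) + 1)
      fun b hb => by rw [hq, hb]; push_cast; rfl, bitExp_add, bitExp_const]
  unfold AffinityBound at ih ⊢
  rcases hj : σ j with _ | x
  · set σ₁ := Function.update σ j (some true)
    set σ₀ := Function.update σ j (some false)
    have hσ₁ : σ₁ j = some true := Function.update_self _ _ _
    have hσ₀ : σ₀ j = some false := Function.update_self _ _ _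
    rw [bitExp_split _ hj, bitExp_split (1 / 2 + δ) hj, bitExp_split (1 / 2 - δ) hj,
      hF' _ _ _ hσ₁, hF' _ _ _ hσ₀, hF' _ _ _ hσ₁, hF' _ _ _ hσ₀, hq' _ _ _ hσ₁, hq' _ _ _ hσ₀]
    have i1 := ih true σ₁
    have i0 := ih false σ₀
    have hmix := affinity_mix (p := 1 / 2 + δ) (q := 1 / 2 - δ) (by linarith) (by linarith)
      (by ring)
      (bitExp_mem_Icc (p := 1 / 2 + δ) (by linarith) (by linarith) σ₁
        fun b => hF ((T true).output (G b)))
      (bitExp_mem_Icc (p := 1 / 2 + δ) (by linarith) (by linarith) σ₀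
        fun b => hF ((T false).output (G b)))
      (bitExp_mem_Icc (p := 1 / 2 - δ) (by linarith) (by linarith) σ₁
        fun b => hF ((T true).output (G b)))
      (bitExp_mem_Icc (p := 1 / 2 - δ) (by linarith) (by linarith) σ₀
        fun b => hF ((T false).output (G b)))
    have hpq : √((1 / 2 + δ) * (1 / 2 - δ)) = θ / 2 := by
      rw [show (1 / 2 + δ) * (1 / 2 - δ) = (1 - 4 * δ ^ 2) / 2 ^ 2 by ring,
        Real.sqrt_div' _ (by positivity), Real.sqrt_sq (by norm_num)]
    rw [hpq] at hmix
    rw [show 1 - (1 / 2 + δ) = 1 / 2 - δ by ring, show 1 - (1 / 2 - δ) = 1 / 2 + δ by ring]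
    refine le_trans ?_ hmix
    have hθ0 : 0 ≤ θ := Real.sqrt_nonneg _
    have hc1 : 0 ≤ bitExp (1 / 2) σ₁ fun b => ((T true).queries (G b) : ℝ) :=
      (bitExp_const (1 / 2) σ₁ 0).symm.trans_le
        (bitExp_mono (by norm_num) (by norm_num) σ₁ fun b => Nat.cast_nonneg _)
    have hc0 : 0 ≤ bitExp (1 / 2) σ₀ fun b => ((T false).queries (G b) : ℝ) :=
      (bitExp_const (1 / 2) σ₀ 0).symm.trans_le
        (bitExp_mono (by norm_num) (by norm_num) σ₀ fun b => Nat.cast_nonneg _)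
    have i2 := mul_le_mul_of_nonneg_left (add_le_add i1 i0) (by linarith : 0 ≤ θ / 2)
    refine le_trans ?_ i2
    nlinarith [mul_nonneg (sub_nonneg.2 hθ1) hc1, mul_nonneg (sub_nonneg.2 hθ1) hc0,
      mul_nonneg (sub_nonneg.2 hθ1) (mul_nonneg (sub_nonneg.2 hθ1) hc1),
      mul_nonneg (sub_nonneg.2 hθ1) (mul_nonneg (sub_nonneg.2 hθ1) hc0)]
  · rw [hF' _ _ _ hj, hF' _ _ _ hj, hq' _ _ _ hj]
    have := ih x σ
    linarith

theorem affinityBound_of_answersLocally {G : (ι → Bool) → OracleGraph n} {π : Fin n → ι}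
    (hG : AnswersLocally G π) {F : ℝ → ℝ} (hF : ∀ x, F x ∈ Set.Icc (0 : ℝ) 1) {δ : ℝ}
    (hδ0 : 0 ≤ δ) (hδ : δ ≤ 1 / 2) (t : QueryTree n) (σ : ι → Option Bool) :
    AffinityBound G F δ t σ := by
  induction t generalizing σ with
  | ret x =>
    unfold AffinityBound affinity
    simp only [QueryTree.queries, QueryTree.output, bitExp_const]
    rw [Real.sqrt_mul_self (hF x).1, Real.sqrt_mul_self (sub_nonneg.2 (hF x).2)]
    simp
  | askDegree v next ih =>
    -- The answer depends on the bit `π v` alone, so a constant assignment can stand for all those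
    -- with that bit.
    refine affinityBound_step hF hδ0 hδ (π v) _ (fun x => next ((G fun _ => x).degree v)) ?_ ?_
      (fun x σ => ih _ σ) σ
    · intro b
      rw [QueryTree.output, (hG v b (fun _ => b (π v)) rfl).1]
    · intro b
      rw [QueryTree.queries, (hG v b (fun _ => b (π v)) rfl).1]
  | askNeighbor v i next ih =>
    refine affinityBound_step hF hδ0 hδ (π v) _ (fun x => next ((G fun _ => x).neighbor v i)) ?_ ?_
      (fun x σ => ih _ σ) σ
    · intro b
      rw [QueryTree.output, (hG v b (fun _ => b (π v)) rfl).2]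
    · intro b
      rw [QueryTree.queries, (hG v b (fun _ => b (π v)) rfl).2]

theorem bitExp_output_sub_le {G : (ι → Bool) → OracleGraph n} {π : Fin n → ι}
    (hG : AnswersLocally G π) {F : ℝ → ℝ} (hF : ∀ x, F x ∈ Set.Icc (0 : ℝ) 1) {δ : ℝ}
    (hδ0 : 0 ≤ δ) (hδ : δ ≤ 1 / 2) (t : QueryTree n) (σ : ι → Option Bool) :
    bitExp (1 / 2 + δ) σ (fun b => F (t.output (G b)))
      - bitExp (1 / 2 - δ) σ (fun b => F (t.output (G b)))
      ≤ 1 / 16 + 128 * δ ^ 2 * bitExp (1 / 2) σ (fun b => (t.queries (G b) : ℝ)) := by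
  have h := affinityBound_of_answersLocally hG hF hδ0 hδ t σ
  unfold AffinityBound at h
  have hsq := sq_sub_le_of_affinity
    (bitExp_mem_Icc (p := 1 / 2 + δ) (by linarith) (by linarith) σ fun b => hF (t.output (G b)))
    (bitExp_mem_Icc (p := 1 / 2 - δ) (by linarith) (by linarith) σ fun b => hF (t.output (G b)))
  have hθ : 1 - √(1 - 4 * δ ^ 2) ≤ 4 * δ ^ 2 := by
    have h0 : 0 ≤ 1 - 4 * δ ^ 2 := by nlinarith
    have : 1 - 4 * δ ^ 2 ≤ √(1 - 4 * δ ^ 2) := Real.le_sqrt_of_sq_le (by nlinarith [sq_nonneg δ])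
    linarith
  have hc : 0 ≤ bitExp (1 / 2) σ fun b => (t.queries (G b) : ℝ) :=
    (bitExp_const (1 / 2) σ 0).symm.trans_le
      (bitExp_mono (by norm_num) (by norm_num) σ fun b => Nat.cast_nonneg _)
  have h2 := mul_le_mul_of_nonneg_right hθ hc
  set D := bitExp (1 / 2 + δ) σ (fun b => F (t.output (G b)))
      - bitExp (1 / 2 - δ) σ (fun b => F (t.output (G b)))
  -- `D ≤ 1 / 16 + 4 * D²` makes the bound linear in the expected number of queries, so that it can
  -- be averaged over the randomness of the algorithm.
  nlinarith [sq_nonneg (D - 1 / 8)]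

end Indistinguishability

/-! ### Random matchings and the lower bound -/

section Matching

variable {n : ℕ}

/-- The largest even number that is at most `v`. -/
def pairIndex (v : Fin n) : Fin n := ⟨v - v % 2, by omega⟩

/-- The graph in which the vertices `2 j` and `2 j + 1` are joined if the bit `2 j` is set. -/
def pairGraph (b : Fin n → Bool) : SimpleGraph (Fin n) where
  Adj v w := v ≠ w ∧ pairIndex v = pairIndex w ∧ b (pairIndex v) = true
  symm := ⟨fun _ _ h => ⟨h.1.symm, h.2.1.symm, h.2.1 ▸ h.2.2⟩⟩
  loopless := ⟨fun _ h => h.1 rfl⟩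

/-- A listing of a set of vertices that depends on the set only. -/
def enumSet (s : Set (Fin n)) : Fin s.ncard ≃ s := (Finite.equivFin s).symm

/-- The matching encoded by `b`, with oracles. -/
def pairOracle (b : Fin n → Bool) : OracleGraph n where
  graph := pairGraph b
  neighbors v := enumSet ((pairGraph b).neighborSet v)

theorem pairOracle_answersLocally : AnswersLocally (pairOracle (n := n)) pairIndex := by
  intro v b b' h
  have hs : (pairGraph b).neighborSet v = (pairGraph b').neighborSet v := by
    ext w
    simp [pairGraph, h]
  have hd : ∀ b : Fin n → Bool, ∀ i, (pairOracle b).neighbor v i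
      = (fun s : Set (Fin n) => if h : i < s.ncard then some (enumSet s ⟨i, h⟩ : Fin n) else none)
        ((pairGraph b).neighborSet v) := fun _ _ => rfl
  refine ⟨congrArg Set.ncard hs, fun i => ?_⟩
  rw [hd, hd, hs]

theorem pairOracle_degree_le_one (b : Fin n → Bool) (v : Fin n) : (pairOracle b).degree v ≤ 1 := by
  change ((pairGraph b).neighborSet v).ncard ≤ 1
  rw [Set.ncard_le_one]
  intro w hw x hx
  have hw1 := hw.1
  have hx1 := hx.1
  have hw2 := hw.2.1
  have hx2 := hx.2.1
  simp only [pairIndex, Fin.ext_iff, ne_eq] at *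
  omega

/-- The even vertices that are not the last vertex. -/
def pairStarts (n : ℕ) : Finset (Fin n) :=
  Finset.univ.filter fun v => (v : ℕ) % 2 = 0 ∧ (v : ℕ) + 1 < n

theorem le_card_pairStarts (n : ℕ) : n / 2 ≤ (pairStarts n).card := by
  have h := Finset.card_le_card_of_injOn (s := (Finset.univ : Finset (Fin (n / 2))))
    (t := pairStarts n) (fun i => ⟨2 * i, by omega⟩)
    (fun i _ => by
      simp only [pairStarts, Finset.coe_filter, Finset.mem_univ, true_and, Set.mem_ofPred_eq]
      omega)
    (fun i _ j _ h => by
      simp only [Fin.mk.injEq] at h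
      exact Fin.ext (by omega))
  simpa using h

theorem occRatio_eq_of_nonNeighbors_eq {V : Type*} [DecidableEq V] (G : SimpleGraph V) {lam : ℝ}
    (hlam : 0 < lam) {S : Finset V} {v : V} (h : nonNeighbors G S v = S) :
    occRatio G lam S v = lam := by
  have := (partitionOn_pos G hlam S).ne'
  rw [occRatio, h]
  field_simp

/-- The loss in `log Z` that an edge between two isolated vertices causes. -/
def edgeCost (lam : ℝ) : ℝ := 2 * Real.log (1 + lam) - Real.log (1 + 2 * lam)

theorem edgeCost_pos {lam : ℝ} (hlam : 0 < lam) : 0 < edgeCost lam := by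
  rw [edgeCost, sub_pos, ← Nat.cast_two, ← Real.log_pow]
  apply Real.log_lt_log <;> push_cast <;> nlinarith

/-- Only later vertices count, so each edge is charged to its smaller endpoint, where `1 + x` is `(1
+ 2 * lam) / (1 + lam)`; all other vertices have `x = lam`. -/
theorem log_one_add_occRatio_pairGraph (b : Fin n → Bool) {lam : ℝ} (hlam : 0 < lam) (v : Fin n) :
    Real.log (1 + occRatio (pairGraph b) lam (Finset.univ.filter (v < ·)) v)
      = Real.log (1 + lam) -
        edgeCost lam * if v ∈ pairStarts n then (if b v then 1 else 0) else 0 := by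
  classical
  set T := Finset.univ.filter (v < ·) with hT
  have hmemT : ∀ w, w ∈ T ↔ (v : ℕ) < w := fun w => by
    rw [hT, Finset.mem_filter, Fin.lt_def]
    exact and_iff_right (Finset.mem_univ w)
  by_cases hv : v ∈ pairStarts n ∧ b v = true
  · rw [if_pos hv.1, if_pos hv.2, mul_one]
    obtain ⟨hvs, hb⟩ := hv
    simp only [pairStarts, Finset.mem_filter, Finset.mem_univ, true_and] at hvs
    have hπ : pairIndex v = v := Fin.ext (by simp only [pairIndex]; omega)
    let u : Fin n := ⟨v + 1, hvs.2⟩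
    have huT : u ∈ T := (hmemT u).2 (by simp [u])
    have hnv : nonNeighbors (pairGraph b) T v = T.erase u := by
      ext w
      simp only [nonNeighbors, Finset.mem_filter, Finset.mem_erase, hmemT, pairGraph, hπ, hb,
        and_true]
      simp only [pairIndex, Fin.ext_iff, ne_eq, u]
      omega
    have hnu : nonNeighbors (pairGraph b) (T.erase u) u = T.erase u := by
      rw [nonNeighbors, Finset.filter_eq_self]
      intro w hw hadj
      rw [Finset.mem_erase, hmemT] at hw
      have h1 := hadj.1
      have h2 := hadj.2.1
      simp only [pairIndex, Fin.ext_iff, ne_eq, u] at *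
      omega
    have hZ := partitionOn_insert_eq_mul (pairGraph b) hlam (Finset.notMem_erase u T)
    rw [Finset.insert_erase huT, occRatio_eq_of_nonNeighbors_eq _ hlam hnu] at hZ
    have hpos := partitionOn_pos (pairGraph b) hlam (T.erase u)
    have hρ : 1 + occRatio (pairGraph b) lam T v = (1 + 2 * lam) / (1 + lam) := by
      rw [occRatio, hnv, hZ]
      field_simp
      ring
    rw [hρ, Real.log_div (by positivity) (by positivity), edgeCost]
    ring
  · have h0 : (if v ∈ pairStarts n then (if b v then (1 : ℝ) else 0) else 0) = 0 := by
      split_ifs with h1 h2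
      · exact absurd ⟨h1, h2⟩ hv
      · rfl
      · rfl
    rw [h0, mul_zero, sub_zero, occRatio_eq_of_nonNeighbors_eq _ hlam]
    rw [nonNeighbors, Finset.filter_eq_self]
    intro w hw hadj
    rw [hmemT] at hw
    obtain ⟨h1, h2, h3⟩ := hadj
    apply hv
    have hπ : pairIndex v = v := by
      simp only [pairIndex, Fin.ext_iff] at *
      omega
    refine ⟨?_, hπ ▸ h3⟩
    simp only [pairStarts, Finset.mem_filter, Finset.mem_univ, true_and]
    have := w.2
    simp only [pairIndex, Fin.ext_iff] at *
    omega

theorem log_indepPartition_pairGraph (b : Fin n → Bool) {lam : ℝ} (hlam : 0 < lam) :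
    Real.log (indepPartition (pairGraph b) lam)
      = n * Real.log (1 + lam) - edgeCost lam * ∑ v ∈ pairStarts n, (if b v then 1 else 0) := by
  rw [log_indepPartition_eq_sum _ hlam]
  simp only [log_one_add_occRatio_pairGraph b hlam, Finset.sum_sub_distrib, ← Finset.mul_sum,
    Finset.sum_ite_mem, Finset.univ_inter]
  simp

end Matching

theorem integral_bitExp {ι Ω : Type*} [Fintype ι] [DecidableEq ι] [MeasurableSpace Ω]
    (μ : Measure Ω) (p : ℝ) (σ : ι → Option Bool) (f : (ι → Bool) → Ω → ℝ)
    (hf : ∀ b, Integrable (f b) μ) :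
    Integrable (fun ω => bitExp p σ fun b => f b ω) μ ∧
      ∫ ω, bitExp p σ (fun b => f b ω) ∂μ = bitExp p σ fun b => ∫ ω, f b ω ∂μ := by
  refine ⟨integrable_finsetSum _ fun b _ => (hf b).const_mul _, ?_⟩
  simp only [bitExp]
  rw [integral_finsetSum _ fun b _ => (hf b).const_mul _]
  simp only [integral_const_mul]

theorem RandQueryAlg.integrable_queries {n : ℕ} (A : RandQueryAlg n) (G : OracleGraph n) {q : ℝ}
    (hq0 : 0 ≤ q) (h : A.expectedQueries G ≤ ENNReal.ofReal q) :
    Integrable (fun ω => ((A.tree ω).queries G : ℝ)) A.μ ∧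
      ∫ ω, ((A.tree ω).queries G : ℝ) ∂A.μ ≤ q := by
  have hm : Measurable fun ω => ((A.tree ω).queries G : ℝ) :=
    (measurable_from_top (f := fun k : ℕ => (k : ℝ))).comp (A.measurable_queries G)
  have e : ∫⁻ ω, ENNReal.ofReal ((A.tree ω).queries G : ℝ) ∂A.μ = A.expectedQueries G := by
    simp only [ENNReal.ofReal_natCast, RandQueryAlg.expectedQueries]
  have h0 : 0 ≤ᵐ[A.μ] fun ω => ((A.tree ω).queries G : ℝ) :=
    Filter.Eventually.of_forall fun ω => Nat.cast_nonneg _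
  constructor
  · rw [← lintegral_ofReal_ne_top_iff_integrable hm.aestronglyMeasurable h0, e]
    exact (h.trans_lt ENNReal.ofReal_lt_top).ne
  · rw [integral_eq_lintegral_of_nonneg_ae h0 hm.aestronglyMeasurable, e]
    exact ENNReal.toReal_le_of_le_ofReal hq0 h

-- Integrates `bitExp_output_sub_le`, with `F` the indicator of outputs at most `x`, over the random
-- choice of the tree.
open Classical in
theorem accept_sub_le {n : ℕ} (A : RandQueryAlg n) {ι : Type*} [Fintype ι] [DecidableEq ι]
    {G : (ι → Bool) → OracleGraph n} {π : Fin n → ι} (hG : AnswersLocally G π) {δ q x : ℝ}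
    (hδ0 : 0 ≤ δ) (hδ : δ ≤ 1 / 2) (hq0 : 0 ≤ q)
    (h : ∀ b, A.expectedQueries (G b) ≤ ENNReal.ofReal q) (σ : ι → Option Bool) :
    bitExp (1 / 2 + δ) σ (fun b => A.μ.real {ω | (A.tree ω).output (G b) ≤ x})
      - bitExp (1 / 2 - δ) σ (fun b => A.μ.real {ω | (A.tree ω).output (G b) ≤ x})
      ≤ 1 / 16 + 128 * δ ^ 2 * q := by
  set F : ℝ → ℝ := (Set.Iic x).indicator 1 with hF
  have hF01 : ∀ y, F y ∈ Set.Icc (0 : ℝ) 1 := by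
    intro y
    by_cases hy : y ∈ Set.Iic x
    · simp [hF, Set.indicator_of_mem hy]
    · simp [hF, Set.indicator_of_notMem hy]
  have hFm : ∀ b, Measurable fun ω => F ((A.tree ω).output (G b)) := fun b =>
    (measurable_one.indicator measurableSet_Iic).comp (A.measurable_output (G b))
  have hFint : ∀ b, Integrable (fun ω => F ((A.tree ω).output (G b))) A.μ := fun b =>
    Integrable.of_bound (hFm b).aestronglyMeasurable 1 (Filter.Eventually.of_forall fun ω => by
      rw [Real.norm_of_nonneg (hF01 _).1]; exact (hF01 _).2)
  have hFeq : ∀ b, ∫ ω, F ((A.tree ω).output (G b)) ∂A.μ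
      = A.μ.real {ω | (A.tree ω).output (G b) ≤ x} := fun b => by
    exact integral_indicator_one (μ := A.μ)
      (A.measurable_output (G b) (measurableSet_Iic (a := x)))
  have hq := fun b => A.integrable_queries (G b) hq0 (h b)
  obtain ⟨i1, e1⟩ := integral_bitExp A.μ (1 / 2 + δ) σ _ hFint
  obtain ⟨i2, e2⟩ := integral_bitExp A.μ (1 / 2 - δ) σ _ hFint
  obtain ⟨i3, e3⟩ := integral_bitExp A.μ (1 / 2) σ _ fun b => (hq b).1
  have key := integral_mono (i1.sub i2) ((integrable_const (1 / 16 : ℝ)).add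
    (i3.const_mul (128 * δ ^ 2)))
    fun ω => bitExp_output_sub_le hG hF01 hδ0 hδ (A.tree ω) σ
  simp only [Pi.sub_apply, Pi.add_apply] at key
  rw [integral_sub i1 i2, integral_add (integrable_const _) (i3.const_mul _), integral_const_mul,
    e1, e2, e3] at key
  simp only [hFeq, integral_const, probReal_univ, one_smul] at key
  have hle : bitExp (1 / 2) σ (fun b => ∫ ω, ((A.tree ω).queries (G b) : ℝ) ∂A.μ) ≤ q :=
    (bitExp_mono (by norm_num) (by norm_num) σ fun b => (hq b).2).trans_eq (bitExp_const _ _ _)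
  have := mul_le_mul_of_nonneg_left hle (show 0 ≤ 128 * δ ^ 2 by positivity)
  linarith

open Classical in
theorem exists_le_expectedQueries {lam : ℝ} (hlam : 0 < lam) {n : ℕ} {ε : ℝ}
    (hε : edgeCost lam / √n < ε) (hε' : ε < edgeCost lam / 24) (hn : 0 < n) (A : RandQueryAlg n)
    {d : ℕ} (hd : 1 ≤ d)
    (hA : A.IsApproximation d (fun G => Real.log (indepPartition G lam)) (ε * n)) :
    ∃ G : OracleGraph n, G.MaxDegreeLE d ∧
      ENNReal.ofReal (edgeCost lam ^ 2 / 294912 / ε ^ 2) ≤ A.expectedQueries G := by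
  set γ := edgeCost lam with hγ
  have hγ0 : 0 < γ := edgeCost_pos hlam
  have hn' : (0 : ℝ) < n := by exact_mod_cast hn
  have hsq : 0 < √(n : ℝ) := Real.sqrt_pos.2 hn'
  have hε0 : 0 < ε := (div_pos hγ0 hsq).trans hε
  have hγε : γ < ε * √n := (div_lt_iff₀ hsq).1 hε
  have hγε2 : γ ^ 2 < ε ^ 2 * n := by
    have := pow_lt_pow_left₀ hγε hγ0.le two_ne_zero
    rwa [mul_pow, Real.sq_sqrt hn'.le] at this
  -- For `n = 1` the two bounds on `ε` contradict each other. At least one pair is needed for `n ≤ 3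
  -- * m`.
  have hn2 : 2 ≤ n := by
    by_contra hlt
    have h1 : n = 1 := by omega
    rw [h1] at hγε
    simp only [Nat.cast_one, Real.sqrt_one, mul_one] at hγε
    linarith
  set m := (pairStarts n).card with hm
  have hmn : (n : ℝ) ≤ 3 * m := by
    have h1 := le_card_pairStarts n
    have : n ≤ 3 * m := by omega
    exact_mod_cast this
  have hm0 : (0 : ℝ) < m := by linarith
  set δ := 12 * ε / γ with hδ
  have hδ0 : 0 < δ := by positivity
  have hδγ : δ * γ = 12 * ε := by rw [hδ]; field_simp
  have hδ2 : δ ≤ 1 / 2 := by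
    rw [hδ, div_le_iff₀ hγ0]
    linarith
  by_contra! hcon
  have hdeg : ∀ b : Fin n → Bool, (pairOracle b).MaxDegreeLE d :=
    fun b v => (pairOracle_degree_le_one b v).trans hd
  have hq : ∀ b : Fin n → Bool, A.expectedQueries (pairOracle b)
      ≤ ENNReal.ofReal (γ ^ 2 / 294912 / ε ^ 2) := fun b => (hcon _ (hdeg b)).le
  -- The value of `log Z` with exactly half of the edges present; it separates the two biases.
  set x := n * Real.log (1 + lam) - γ * (m / 2) with hx
  have hdiff := accept_sub_le A pairOracle_answersLocally (x := x) hδ0.le hδ2 (by positivity) hq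
    fun _ => none
  have hval : 128 * δ ^ 2 * (γ ^ 2 / 294912 / ε ^ 2) = 1 / 16 := by
    rw [hδ]
    field_simp
    norm_num
  rw [hval] at hdiff
  -- Half the distance from the mean edge number to `m / 2`. If the edge number deviates by less
  -- than `t`, then `log Z` is at least `γ * t ≥ 2 * (ε * n)` away from `x`.
  set t := δ * m / 2 with ht
  have ht0 : 0 < t := by positivity
  have hγt : 2 * (ε * n) ≤ γ * t := by
    have e : γ * t = 6 * ε * m := by rw [ht]; linear_combination (m / 2 : ℝ) * hδγ
    rw [e]
    nlinarith
  have hεn : 0 < ε * n := by positivity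
  -- The Chebyshev failure probability equals `1 / (δ² * m)`; the lower bound on `ε` keeps it small.
  have hsmall : (m : ℝ) / (4 * t ^ 2) ≤ 1 / 24 := by
    rw [div_le_div_iff₀ (by positivity) (by norm_num)]
    have h1 : (δ * γ) ^ 2 = 144 * ε ^ 2 := by rw [hδγ]; ring
    have h2 : 24 * γ ^ 2 ≤ δ ^ 2 * m * γ ^ 2 := by
      have : δ ^ 2 * m * γ ^ 2 = 144 * ε ^ 2 * m := by rw [← h1]; ring
      rw [this]
      nlinarith [sq_nonneg ε]
    have h3 : 24 ≤ δ ^ 2 * m := le_of_mul_le_mul_right h2 (by positivity)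
    have e : 1 * (4 * t ^ 2) = δ ^ 2 * m * m := by rw [ht]; ring
    rw [e]
    nlinarith
  set dev : ℝ → (Fin n → Bool) → ℝ := fun p b =>
    ∑ v ∈ pairStarts n, ((if b v then 1 else 0) - p) with hdev
  have hdevK : ∀ p b, dev p b = ∑ v ∈ pairStarts n, (if b v then (1 : ℝ) else 0) - p * m := by
    intro p b
    simp only [hdev, Finset.sum_sub_distrib, Finset.sum_const, nsmul_eq_mul, ← hm]
    ring
  have happrox : ∀ b : Fin n → Bool, 2 / 3 ≤ A.μ.real {ω | |(A.tree ω).output (pairOracle b)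
      - Real.log (indepPartition (pairGraph b) lam)| ≤ ε * n} := fun b => hA _ (hdeg b)
  have hZ := fun b : Fin n → Bool => log_indepPartition_pairGraph b hlam
  have hplus : ∀ b : Fin n → Bool, 2 / 3 - (if t ≤ |dev (1 / 2 + δ) b| then 1 else 0)
      ≤ A.μ.real {ω | (A.tree ω).output (pairOracle b) ≤ x} := by
    intro b
    split_ifs with hb
    · have := measureReal_nonneg (μ := A.μ) (s := {ω | (A.tree ω).output (pairOracle b) ≤ x})
      linarith
    · rw [sub_zero]
      refine (happrox b).trans (measureReal_mono fun ω hω => ?_)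
      simp only [Set.mem_ofPred_eq] at hω ⊢
      rw [hZ b] at hω
      have h1 := (abs_le.1 hω).2
      have h2 := (abs_lt.1 (not_le.1 hb)).1
      rw [hdevK] at h2
      have h3 : γ * (m / 2 + t) ≤ γ * ∑ v ∈ pairStarts n, (if b v then (1 : ℝ) else 0) :=
        mul_le_mul_of_nonneg_left (by linarith) hγ0.le
      rw [mul_add] at h3
      linarith
  have hminus : ∀ b : Fin n → Bool, A.μ.real {ω | (A.tree ω).output (pairOracle b) ≤ x}
      ≤ 1 / 3 + (if t ≤ |dev (1 / 2 - δ) b| then 1 else 0) := by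
    intro b
    split_ifs with hb
    · have := measureReal_le_one (μ := A.μ) (s := {ω | (A.tree ω).output (pairOracle b) ≤ x})
      linarith
    · have hS := A.measurable_output (pairOracle b) (measurableSet_Iic (a := x))
      have hc := probReal_compl_eq_one_sub (μ := A.μ) hS
      have hle : 2 / 3 ≤ A.μ.real ((fun ω => (A.tree ω).output (pairOracle b)) ⁻¹' Set.Iic x)ᶜ := by
        refine (happrox b).trans (measureReal_mono fun ω hω => ?_)
        simp only [Set.mem_ofPred_eq, Set.mem_compl_iff, Set.mem_preimage, Set.mem_Iic,
          not_le] at hω ⊢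
        rw [hZ b] at hω
        have h1 := (abs_le.1 hω).1
        have h2 := (abs_lt.1 (not_le.1 hb)).2
        rw [hdevK] at h2
        have h3 : γ * ∑ v ∈ pairStarts n, (if b v then (1 : ℝ) else 0) ≤ γ * (m / 2 - t) :=
          mul_le_mul_of_nonneg_left (by linarith) hγ0.le
        rw [mul_sub] at h3
        linarith
      have e : {ω | (A.tree ω).output (pairOracle b) ≤ x}
          = (fun ω => (A.tree ω).output (pairOracle b)) ⁻¹' Set.Iic x := rfl
      rw [e]
      linarith
  have b1 := bitExp_mono (p := 1 / 2 + δ) (by linarith) (by linarith) (fun _ => none) hplus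
  have b2 := bitExp_mono (p := 1 / 2 - δ) (by linarith) (by linarith) (fun _ => none) hminus
  rw [bitExp_sub, bitExp_const] at b1
  rw [bitExp_add, bitExp_const] at b2
  have d1 := bitExp_deviation_le (p := 1 / 2 + δ) (by linarith) (by linarith) ht0 (pairStarts n)
  have d2 := bitExp_deviation_le (p := 1 / 2 - δ) (by linarith) (by linarith) ht0 (pairStarts n)
  -- The acceptance probabilities differ by at least `(2/3 - 1/24) - (1/3 + 1/24) = 1/4`, whereas
  -- `hdiff` allows only `1/16 + 1/16`.
  linarith

end

theorem mainTheorem7 (Δ : ℕ) (hΔ : 2 ≤ Δ) (lam : ℝ) (hlam : 0 < lam)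
    (hlam' : lam < criticalActivity Δ) :
    (∃ (A : (n : ℕ) → ℝ → RandQueryAlg n) (P : Polynomial ℝ),
      ∀ (n : ℕ) (ε : ℝ), 0 < ε →
        (A n ε).IsApproximation (Δ + 1) (fun G => Real.log (indepPartition G lam)) (ε * n) ∧
        ∀ G : OracleGraph n, G.MaxDegreeLE (Δ + 1) →
          ∀ ω : (A n ε).Ω, (((A n ε).tree ω).queries G : ℝ) ≤ P.eval (1 / ε)) ∧
    (∃ c > (0 : ℝ), ∃ C > (0 : ℝ), ∃ ε₀ > (0 : ℝ),
      ∀ (n : ℕ) (ε : ℝ), 0 < n → C / Real.sqrt n < ε → ε < ε₀ →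
        ∀ A : RandQueryAlg n,
          A.IsApproximation (Δ + 1) (fun G => Real.log (indepPartition G lam)) (ε * n) →
          ∃ G : OracleGraph n, G.MaxDegreeLE (Δ + 1) ∧
            ENNReal.ofReal (c / ε ^ 2) ≤ A.expectedQueries G) := by
  have hγ := edgeCost_pos hlam
  exact ⟨exists_samplingAlg Δ hΔ lam hlam hlam', edgeCost lam ^ 2 / 294912, by positivity,
    edgeCost lam, hγ, edgeCost lam / 24, by positivity, fun n ε hn h1 h2 A hA =>
      exists_le_expectedQueries hlam h1 h2 hn A (Nat.le_add_left 1 Δ) hA⟩
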